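/- Let $\tilde e\subset\mathbb{R}^3$ be the closed reference tetrahedron with vertices $(0,0,0),(1,0,0),(0,1,0),(0,0,1)$, and let $\mathcal{P}_q$ be the space of polynomials in three variables of degree at most $q$. Let $\tilde U$ be a space of polynomials in three variables, let $D\tilde U$ be the linear span of all first-order partial derivatives of functions in $\tilde U$, let $\tilde{\mathcal Q}\subset\tilde e$ be a finite set of nodes, and let $\tilde{\mathcal Q}'\subset\tilde e$ be a finite set of quadrature points with weights $\tilde\omega'_{\tilde x}\in\mathbb{R}$, $\tilde x\in\tilde{\mathcal Q}'$. Let $p$ be the degree of the element, i.e. the largest integer with $\mathcal{P}_p\subset\tilde U$, and assume $p\ge 2$. Assume the following conditions. - C1: $\tilde U$ is unisolvent on $\tilde{\mathcal Q}$, i.e. $\tilde u\mapsto(\tilde u(\tilde x))_{\tilde x\in\tilde{\mathcal Q}}$ is a bijection $\tilde U\to\mathbb{R}^{\tilde{\mathcal Q}}$. - C2: $\tilde U$ and $\tilde{\mathcal Q}$ are invariant under all affine maps that map $\tilde e$ onto itself. - C3: if $\tilde u\in\tilde U$ is zero at all nodes in $\tilde{\mathcal Q}\cap\tilde f$, with $\tilde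 f$ a face of $\tilde e$, then $\tilde u$ is zero on $\tilde f$. - C6: $\tilde\omega'_{\tilde x}>0$ for all $\tilde x\in\tilde{\mathcal Q}'$. - C8: $\int_{\tilde e} fg\,d\tilde x=\sum_{\tilde x\in\tilde{\mathcal Q}'}\tilde\omega'_{\tilde x}f(\tilde x)g(\tilde x)$ for all $f\in\mathcal{P}_{p-1}$ and $g\in D\tilde U$. Then there is a constant $C>0$, depending only on $\tilde U$, $p$, the nodes $\tilde{\mathcal Q}$ and the quadrature rule $(\tilde{\mathcal Q}',\tilde\omega')$, such that the following holds. Let $\Omega\subset\mathbb{R}^3$ be open and bounded, and let $\mathcal{T}_h$ be a conforming tetrahedral mesh of $\Omega$: finitely many nondegenerate closed tetrahedra $e$ whose union is $\overline\Omega$, whose interiors are pairwise disjoint and contained in $\Omega$, and any two of which meet in the (possibly empty) convex hull of their common vertices. Each $e$ comes with an affine bijection $\phi_e:\tilde e\to e$. Let $h$ be the smallest radius such that each $e\in\mathcal{T}_h$ is contained in a ball of radius $h$. Let $k\ge 2$ be an integer, let $\sigma\in H^k(\mathcal{T}_h)^3$, where $H^k(\mathcal{T}_h)=\{u\in L^2(\Omega):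 u|_e\in H^k(e)\ \forall e\in\mathcal{T}_h\}$, and let $\tau\in V(\mathcal{T}_h,D\tilde U)^3$, where $V(\mathcal{T}_h,D\tilde U)=\{u\in L^2(\Omega): u\circ\phi_e\in D\tilde U\ \forall e\in\mathcal{T}_h\}$. Let $$r_h'(\sigma,\tau)=\int_\Omega\sigma\cdot\tau\,dx-\sum_{e\in\mathcal{T}_h}\sum_{\tilde x\in\tilde{\mathcal Q}'}\frac{|e|}{|\tilde e|}\,\tilde\omega'_{\tilde x}\,(\sigma|_e\cdot\tau|_e)(\phi_e(\tilde x)),$$ where the point values on $e$ are those of the continuous representatives of $\sigma|_e$ and $\tau|_e$ on the closed tetrahedron $e$. Then $$|r_h'(\sigma,\tau)|\le C h^{\min(p,k)}\|\sigma\|_{\mathcal{T}_h,\min(p,k)}\|\tau\|_0,$$ $$|r_h'(\sigma,\tau)|\le C h^{\min(p+1,k)}\|\sigma\|_{\mathcal{T}_h,\min(p+1,k)}\|\tau\|_{\mathcal{T}_h,1}.$$ Here $\|\cdot\|_0$ is the $L^2(\Omega)^3$-norm and $\|\sigma\|_{\mathcal{T}_h,m}^2=\sum_{e\in\mathcal{T}_h}\sum_{i=1}^3\sum_{|\alpha|\le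 m}\|D^\alpha\sigma_i\|_{L^2(e)}^2$, with weak derivatives on the interior of $e$. -/

import Mathlib

open MeasureTheory
open scoped ContDiff

noncomputable section

namespace MassLumped

/-- Three-dimensional Euclidean space. -/
abbrev E3 : Type := EuclideanSpace ℝ (Fin 3)

/-! ### Sobolev spaces -/

/-- Classical partial derivative `∂ᵢ f`. -/
def partialD (i : Fin 3) (f : E3 → ℝ) : E3 → ℝ :=
  fun x => fderiv ℝ f x (EuclideanSpace.single i 1)

/-- `D^α f = ∂₁^α₁ ∂₂^α₂ ∂₃^α₃ f`. -/
def multiD (α : Fin 3 → ℕ) (f : E3 → ℝ) : E3 → ℝ :=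
  (partialD 0)^[α 0] ((partialD 1)^[α 1] ((partialD 2)^[α 2] f))

/-- `v` is the weak derivative `D^α u` on the open set `O`. -/
def IsWeakDeriv (O : Set E3) (α : Fin 3 → ℕ) (u v : E3 → ℝ) : Prop :=
  LocallyIntegrableOn u O ∧ LocallyIntegrableOn v O ∧
    ∀ φ : E3 → ℝ, ContDiff ℝ ∞ φ → HasCompactSupport φ → tsupport φ ⊆ O →
      ∫ x in O, u x * multiD α φ x = (-1) ^ (∑ i, α i) * ∫ x in O, v x * φ x

/-- The multi-indices `α` with `|α| ≤ k`. -/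
def multiIndices (k : ℕ) : Finset (Fin 3 → ℕ) :=
  (Fintype.piFinset fun _ => Finset.range (k + 1)).filter fun α => ∑ i, α i ≤ k

/-- `u` (restricted to the open set `O`) belongs to `H^k(O)`. -/
def MemSobolev (k : ℕ) (O : Set E3) (u : E3 → ℝ) : Prop :=
  ∀ α ∈ multiIndices k, ∃ v, MemLp v 2 (volume.restrict O) ∧ IsWeakDeriv O α u v

open Classical in
/-- The square-integrable weak derivative `D^α u` on `O`, unique up to null sets
(and `0` if there is none). -/
def weakD (O : Set E3) (α : Fin 3 → ℕ) (u : E3 → ℝ) : E3 → ℝ :=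
  if h : ∃ v, MemLp v 2 (volume.restrict O) ∧ IsWeakDeriv O α u v then h.choose else 0

/-- `‖u‖_{H^k(O)}²`, for `u ∈ H^k(O)`. -/
def sobolevNormSq (k : ℕ) (O : Set E3) (u : E3 → ℝ) : ℝ :=
  ∑ α ∈ multiIndices k, ∫ x in O, weakD O α u x ^ 2

open Classical in
/-- The continuous representative, on the closed set `K`, of a function given up to null sets
(and `0` if there is none). On a closed tetrahedron it is unique at every point of `K`. -/
def contRep (K : Set E3) (u : E3 → ℝ) : E3 → ℝ :=
  if h : ∃ g : E3 → ℝ, ContinuousOn g K ∧ g =ᵐ[volume.restrict K] u then h.choose else 0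

/-! ### The reference tetrahedron, reference spaces and reference quadrature -/

/-- Barycentric coordinates of the reference tetrahedron. -/
def bary (x : E3) : Fin 4 → ℝ := ![x 0, x 1, x 2, 1 - x 0 - x 1 - x 2]

/-- The closed reference tetrahedron, with vertices `(0,0,0)`, `(1,0,0)`, `(0,1,0)`, `(0,0,1)`. -/
def refTet : Set E3 := {x | ∀ j, 0 ≤ bary x j}

/-- The four closed faces of the reference tetrahedron. -/
def refFace (j : Fin 4) : Set E3 := {x ∈ refTet | bary x j = 0}

/-- Polynomials in three variables. -/
abbrev Poly3 : Type := MvPolynomial (Fin 3) ℝ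

/-- Value of a polynomial at a point. -/
def polyEval (f : Poly3) (x : E3) : ℝ := MvPolynomial.eval (fun i => x i) f

/-- `P_q`, the polynomials of degree at most `q`. -/
abbrev polySpace (q : ℕ) : Submodule ℝ Poly3 := MvPolynomial.restrictTotalDegree (Fin 3) ℝ q

/-- `D U`, the space of (linear combinations of) partial derivatives of functions in `U`. -/
def derivSpace (U : Submodule ℝ Poly3) : Submodule ℝ Poly3 :=
  Submodule.span ℝ {f | ∃ i : Fin 3, ∃ u ∈ U, f = MvPolynomial.pderiv i u}

/-- A reference element: a space of polynomials and a finite set of nodes in the reference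
tetrahedron. -/
structure RefElement where
  space : Submodule ℝ Poly3
  nodes : Finset E3
  nodes_mem : ∀ x ∈ nodes, x ∈ refTet

namespace RefElement

/-- `p` is the degree of the element: the largest `q` such that `P_q` is contained in the
reference space. -/
def HasDegree (R : RefElement) (p : ℕ) : Prop :=
  IsGreatest {q : ℕ | polySpace q ≤ R.space} p

/-- C1: the reference space is unisolvent on the nodes. -/
def Unisolvent (R : RefElement) : Prop :=
  Function.Bijective fun (u : R.space) (x : R.nodes) => polyEval (u : Poly3) (x : E3)

/-- C2: the reference space and the nodes are invariant under the affine maps that map the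
reference tetrahedron onto itself. -/
def Symmetric (R : RefElement) : Prop :=
  ∀ s : E3 →ᵃ[ℝ] E3, s '' refTet = refTet →
    (∀ u ∈ R.space, ∃ w ∈ R.space, ∀ x, polyEval w x = polyEval u (s x)) ∧
      s '' (R.nodes : Set E3) = R.nodes

/-- C3: a function in the reference space that is zero at all nodes on a face is zero on that
face. -/
def FaceConforming (R : RefElement) : Prop :=
  ∀ j : Fin 4, ∀ u ∈ R.space,
    (∀ x ∈ R.nodes, x ∈ refFace j → polyEval u x = 0) → ∀ x ∈ refFace j, polyEval u x = 0

end RefElement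

/-- A quadrature rule on the reference tetrahedron. -/
structure QuadRule where
  nodes : Finset E3
  nodes_mem : ∀ x ∈ nodes, x ∈ refTet
  weight : E3 → ℝ

namespace QuadRule

/-- C6: all weights are strictly positive. -/
def Positive (S : QuadRule) : Prop := ∀ x ∈ S.nodes, 0 < S.weight x

/-- C8: if `p ≥ 2`, the rule is exact for the functions in `P_{p-1} ⊗ D U`. -/
def StiffnessExact (S : QuadRule) (p : ℕ) (U : Submodule ℝ Poly3) : Prop :=
  2 ≤ p → ∀ f ∈ polySpace (p - 1), ∀ g ∈ derivSpace U,
    ∫ x in refTet, polyEval f x * polyEval g x =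
      ∑ x ∈ S.nodes, S.weight x * (polyEval f x * polyEval g x)

end QuadRule

/-! ### Tetrahedral meshes -/

/-- The affine reference-to-physical element map of the nondegenerate tetrahedron with the
(ordered) vertices `e.points`. -/
def elemMap (e : Affine.Simplex ℝ E3 3) (x : E3) : E3 := ∑ j, bary x j • e.points j

/-- The closed tetrahedron. -/
def cell (e : Affine.Simplex ℝ E3 3) : Set E3 := elemMap e '' refTet

/-- A (conforming) tetrahedral mesh of `Ω`: finitely many nondegenerate closed tetrahedra with
disjoint interiors that fill `Ω`, two of which intersect in the simplex (possibly empty) spanned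
by their common vertices. -/
structure TetMesh (Ω : Set E3) where
  elems : Finset (Affine.Simplex ℝ E3 3)
  cover : ⋃ e ∈ elems, cell e = closure Ω
  interior_subset : ∀ e ∈ elems, interior (cell e) ⊆ Ω
  disjoint_interior : ∀ e ∈ elems, ∀ e' ∈ elems, e ≠ e' →
    Disjoint (interior (cell e)) (interior (cell e'))
  conforming : ∀ e ∈ elems, ∀ e' ∈ elems, e ≠ e' →
    cell e ∩ cell e' = convexHull ℝ (Set.range e.points ∩ Set.range e'.points)

namespace TetMesh

variable {Ω : Set E3}

/-- The mesh size `h`: the radius of the smallest ball that can contain each element. -/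
def size (T : TetMesh Ω) : ℝ :=
  sInf {r : ℝ | 0 ≤ r ∧ ∀ e ∈ T.elems, ∃ c : E3, cell e ⊆ Metric.closedBall c r}

/-- The broken Sobolev space `H^k(T_h)`. -/
def MemBrokenSobolev (T : TetMesh Ω) (k : ℕ) (u : E3 → ℝ) : Prop :=
  MemLp u 2 (volume.restrict Ω) ∧ ∀ e ∈ T.elems, MemSobolev k (interior (cell e)) u

/-- The norm `‖σ‖_{T_h,k}` of a vector field `σ ∈ H^k(T_h)³`. -/
def brokenNorm (T : TetMesh Ω) (k : ℕ) (σ : Fin 3 → E3 → ℝ) : ℝ :=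
  Real.sqrt (∑ e ∈ T.elems, ∑ i, sobolevNormSq k (interior (cell e)) (σ i))

/-- The space `V(T_h, D)` of discontinuous piecewise polynomials with reference space `D`. -/
def MemPiecewise (T : TetMesh Ω) (D : Submodule ℝ Poly3) (u : E3 → ℝ) : Prop :=
  MemLp u 2 (volume.restrict Ω) ∧
    ∀ e ∈ T.elems, ∃ f ∈ D, ∀ᵐ x ∂volume.restrict refTet, u (elemMap e x) = polyEval f x

/-- The approximated `L²` inner product `(σ, τ)_{Q'_h}`. On each closed element, point values are
those of the continuous representatives of the restrictions to that element. -/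
def quadInner (T : TetMesh Ω) (S : QuadRule) (σ τ : Fin 3 → E3 → ℝ) : ℝ :=
  ∑ e ∈ T.elems, ∑ x ∈ S.nodes, volume.real (cell e) / volume.real refTet * S.weight x *
    ∑ i, contRep (cell e) (σ i) (elemMap e x) * contRep (cell e) (τ i) (elemMap e x)

end TetMesh

/-- The `L²(Ω)³` inner product. -/
def l2Inner (Ω : Set E3) (σ τ : Fin 3 → E3 → ℝ) : ℝ := ∫ x in Ω, ∑ i, σ i x * τ i x

/-- The `L²(Ω)³` norm `‖τ‖₀`. -/
def l2Norm (Ω : Set E3) (τ : Fin 3 → E3 → ℝ) : ℝ := Real.sqrt (∫ x in Ω, ∑ i, τ i x ^ 2)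

/-- The integration error `r'_h(σ, τ) = (σ, τ) - (σ, τ)_{Q'_h}`. -/
def quadError {Ω : Set E3} (T : TetMesh Ω) (S : QuadRule) (σ τ : Fin 3 → E3 → ℝ) : ℝ :=
  l2Inner Ω σ τ - T.quadInner S σ τ

end MassLumped

end

/-! The error splits into one contribution per element and per component. Pulled back to the
reference tetrahedron, an element contribution is |e|/|ẽ| times the reference quadrature error
`refErr` of (σ ∘ φ_e) · g, where g ∈ DU represents τ. By C8 this error does not change when a
polynomial of degree at most m ≤ p - 1 is subtracted from σ ∘ φ_e. As φ_e is affine, that polynomial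
may be a Taylor polynomial of σ taken on the physical element.

No shape regularity is assumed, so the remainder must be controlled by the diameter alone. For fixed
x, the Taylor remainder at x is averaged over all centres y ∈ e (`lintegral_sub_taylorAt_le`). The
integral form of the remainder sees the top derivatives along homotheties towards x. These map the
convex element into itself and cost s^(-3/2) in L², against a weight s^m with m ≥ 1, so the integral
over s converges. The bound holds at every x, hence both under the integral and at the quadrature
points. It carries a factor |e|^(1/2), which combines with |e|/|ẽ| to turn the reference L² norm of
g into that of τ. Equivalence of norms on the finite-dimensional space DU bounds g pointwise.

Sobolev functions are reached by density: contraction towards an interior point followed by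
mollification converges in H^k, and by the Sobolev inequality uniformly on the closed element
(`exists_smooth_approx`), so integrals and point values both pass to the limit.

For the second estimate τ is split on each element into a vertex value c and the rest. The rest is
bounded by the gradient of g, which gains one power of h by the chain rule. Against constants the
rule is exact one degree higher: a monomial of degree p is X_i times one of degree p - 1, and X_i ∈
DU because p ≥ 2 (`refErr_one_eq_zero_of_stiffnessExact`). Cauchy–Schwarz sums the element bounds.
-/

noncomputable section

namespace MassLumped

open Filter
open scoped ENNReal Convolution Topology

/-! ### Iterated partial derivatives of smooth functions. -/

section Calculus

theorem contDiff_partialD {f : E3 → ℝ} (hf : ContDiff ℝ ∞ f) (i : Fin 3) :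
    ContDiff ℝ ∞ (partialD i f) :=
  (hf.fderiv_right (m := ∞) (by simp)).clm_apply contDiff_const

theorem contDiff_iterate_partialD {f : E3 → ℝ} (hf : ContDiff ℝ ∞ f) (i : Fin 3) (n : ℕ) :
    ContDiff ℝ ∞ ((partialD i)^[n] f) := by
  induction n with
  | zero => simpa using hf
  | succ n ih => rw [Function.iterate_succ_apply']; exact contDiff_partialD ih i

theorem contDiff_multiD {f : E3 → ℝ} (hf : ContDiff ℝ ∞ f) (α : Fin 3 → ℕ) :
    ContDiff ℝ ∞ (multiD α f) :=
  contDiff_iterate_partialD (contDiff_iterate_partialD (contDiff_iterate_partialD hf _ _) _ _) _ _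

theorem partialD_comm {f : E3 → ℝ} (hf : ContDiff ℝ ∞ f) (i j : Fin 3) :
    partialD i (partialD j f) = partialD j (partialD i f) := by
  have hd : Differentiable ℝ (fderiv ℝ f) :=
    (hf.fderiv_right (m := ∞) (by simp)).differentiable (by simp)
  have key : ∀ (a b : Fin 3) (x : E3), partialD a (partialD b f) x =
      fderiv ℝ (fderiv ℝ f) x (EuclideanSpace.single a 1) (EuclideanSpace.single b 1) := by
    intro a b x
    unfold partialD
    rw [fderiv_clm_apply (hd x) (differentiableAt_const _)]
    simp
  funext x
  rw [key, key]
  have hs : IsSymmSndFDerivAt ℝ f x := hf.contDiffAt.isSymmSndFDerivAt (by simp; exact WithTop.coe_le_coe.2 le_top)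
  exact hs _ _

theorem iterate_partialD_comm {f : E3 → ℝ} (hf : ContDiff ℝ ∞ f) (i j : Fin 3) (n : ℕ) :
    (partialD i)^[n] (partialD j f) = partialD j ((partialD i)^[n] f) := by
  induction n with
  | zero => rfl
  | succ n ih =>
    rw [Function.iterate_succ_apply', Function.iterate_succ_apply', ih,
      partialD_comm (contDiff_iterate_partialD hf i n)]

theorem multiD_partialD {f : E3 → ℝ} (hf : ContDiff ℝ ∞ f) (α : Fin 3 → ℕ) (i : Fin 3) :
    multiD α (partialD i f) = multiD (α + Pi.single i 1) f := by
  have h2 := contDiff_iterate_partialD hf 2 (α 2)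
  have h1 := contDiff_iterate_partialD h2 1 (α 1)
  fin_cases i
  · simp [multiD, iterate_partialD_comm hf, iterate_partialD_comm h2]
  · simp [multiD, iterate_partialD_comm hf]
  · simp [multiD]

theorem multiD_zero (f : E3 → ℝ) : multiD 0 f = f := rfl

theorem multiD_single (f : E3 → ℝ) (i : Fin 3) : multiD (Pi.single i 1) f = partialD i f := by
  fin_cases i <;> simp [multiD]

theorem partialD_const_mul_comp {f : E3 → ℝ} (hf : ContDiff ℝ ∞ f) (c t : ℝ) (b : E3) (i : Fin 3) :
    partialD i (fun x => c * f (t • x + b)) = fun x => (c * t) * partialD i f (t • x + b) := by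
  funext x
  have h1 : HasFDerivAt (fun x : E3 => t • x + b) (t • ContinuousLinearMap.id ℝ E3) x :=
    ((hasFDerivAt_id x).const_smul t).add_const b
  have h2 := ((hf.differentiable (by simp) (t • x + b)).hasFDerivAt.comp x h1).const_mul c
  have h3 : fderiv ℝ (fun x => c * f (t • x + b)) x = _ := h2.fderiv
  simp only [partialD]
  rw [h3]
  simp [mul_assoc]

theorem iterate_partialD_const_mul_comp {f : E3 → ℝ} (hf : ContDiff ℝ ∞ f) (c t : ℝ) (b : E3)
    (i : Fin 3) (n : ℕ) :
    (partialD i)^[n] (fun x => c * f (t • x + b)) =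
      fun x => (c * t ^ n) * (partialD i)^[n] f (t • x + b) := by
  induction n with
  | zero => simp
  | succ n ih =>
    rw [Function.iterate_succ_apply', ih,
      partialD_const_mul_comp (contDiff_iterate_partialD hf i n), Function.iterate_succ_apply']
    funext x; ring

theorem multiD_const_mul_comp {f : E3 → ℝ} (hf : ContDiff ℝ ∞ f) (c t : ℝ) (b : E3)
    (α : Fin 3 → ℕ) :
    multiD α (fun x => c * f (t • x + b)) =
      fun x => (c * t ^ (∑ i, α i)) * multiD α f (t • x + b) := by
  have h2 := contDiff_iterate_partialD hf 2 (α 2)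
  have h1 := contDiff_iterate_partialD h2 1 (α 1)
  unfold multiD
  rw [iterate_partialD_const_mul_comp hf, iterate_partialD_const_mul_comp h2,
    iterate_partialD_const_mul_comp h1]
  funext x
  simp only [Fin.sum_univ_three, pow_add]
  ring

theorem fderiv_eq_sum_partialD (f : E3 → ℝ) (x z : E3) :
    fderiv ℝ f x z = ∑ i, z i * partialD i f x := by
  have : z = ∑ i, z i • EuclideanSpace.single i (1 : ℝ) := by
    ext j
    simp [Pi.single_apply]
  conv_lhs => rw [this]
  simp [partialD]

/-- Partial derivatives of smooth functions commute with differences. -/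
theorem multiD_sub {f g : E3 → ℝ} (hf : ContDiff ℝ ∞ f) (hg : ContDiff ℝ ∞ g) (α : Fin 3 → ℕ) :
    multiD α (fun x => f x - g x) = fun x => multiD α f x - multiD α g x := by
  have step : ∀ (i : Fin 3) (n : ℕ) {f g : E3 → ℝ}, ContDiff ℝ ∞ f → ContDiff ℝ ∞ g →
      (partialD i)^[n] (fun x => f x - g x) =
        fun x => (partialD i)^[n] f x - (partialD i)^[n] g x := by
    intro i n f g hf hg
    induction n with
    | zero => rfl
    | succ n ih =>
      rw [Function.iterate_succ_apply', ih, Function.iterate_succ_apply',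
        Function.iterate_succ_apply']
      funext x
      have h1 := ((contDiff_iterate_partialD hf i n).differentiable (by simp) x).hasFDerivAt
      have h2 := ((contDiff_iterate_partialD hg i n).differentiable (by simp) x).hasFDerivAt
      simp only [partialD]
      rw [(h1.fun_sub h2).fderiv]
      simp
  unfold multiD
  rw [step 2 _ hf hg, step 1 _ (contDiff_iterate_partialD hf _ _) (contDiff_iterate_partialD hg _ _),
    step 0 _ (contDiff_iterate_partialD (contDiff_iterate_partialD hf _ _) _ _)
      (contDiff_iterate_partialD (contDiff_iterate_partialD hg _ _) _ _)]

end Calculus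

section MultiIndex

theorem mem_multiIndices {k : ℕ} {α : Fin 3 → ℕ} : α ∈ multiIndices k ↔ ∑ i, α i ≤ k := by
  simp only [multiIndices, Finset.mem_filter, Fintype.mem_piFinset, Finset.mem_range,
    and_iff_right_iff_imp]
  intro h i
  exact Nat.lt_succ_of_le
    ((Finset.single_le_sum (f := α) (fun _ _ => Nat.zero_le _) (Finset.mem_univ i)).trans h)

/-- The multi-indices of order exactly `k`. -/
def topIndices (k : ℕ) : Finset (Fin 3 → ℕ) := (multiIndices k).filter fun α => ∑ i, α i = k

theorem mem_topIndices {k : ℕ} {α : Fin 3 → ℕ} : α ∈ topIndices k ↔ ∑ i, α i = k := by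
  simp only [topIndices, Finset.mem_filter, mem_multiIndices, and_iff_right_iff_imp]
  exact fun h => h.le

theorem topIndices_subset {j k : ℕ} (h : j ≤ k) : topIndices j ⊆ multiIndices k := fun _ hα =>
  mem_multiIndices.2 ((mem_topIndices.1 hα).trans_le h)

end MultiIndex

/-! ### Taylor expansion in several variables with integral remainder. -/

section Taylor

/-- The `j`-th directional derivative in the direction `z`. -/
def dirPow (z : E3) : ℕ → (E3 → ℝ) → E3 → ℝ
  | 0, v => v
  | j + 1, v => fun ξ => ∑ i, z i * dirPow z j (partialD i v) ξ

theorem hasDerivAt_dirPow (z x : E3) (j : ℕ) {v : E3 → ℝ} (hv : ContDiff ℝ ∞ v) (s : ℝ) :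
    HasDerivAt (fun s : ℝ => dirPow z j v (x - s • z)) (-dirPow z (j + 1) v (x - s • z)) s := by
  induction j generalizing v with
  | zero =>
    have h1 : HasDerivAt (fun s : ℝ => x - s • z) (-z) s := by
      simpa using ((hasDerivAt_id s).smul_const z).const_sub x
    have h2 := (hv.differentiable (by simp) (x - s • z)).hasFDerivAt.comp_hasDerivAt s h1
    have h3 : fderiv ℝ v (x - s • z) (-z) = -dirPow z 1 v (x - s • z) := by
      rw [map_neg, fderiv_eq_sum_partialD]; rfl
    rw [h3] at h2
    exact h2
  | succ j ih =>
    have := HasDerivAt.fun_sum (u := Finset.univ) fun i _ =>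
      (ih (contDiff_partialD hv i)).const_mul (z i)
    refine this.congr_deriv ?_
    simp [dirPow]

theorem continuous_dirPow (j : ℕ) {v : E3 → ℝ} (hv : ContDiff ℝ ∞ v) :
    Continuous fun q : E3 × E3 => dirPow q.1 j v q.2 := by
  induction j generalizing v with
  | zero => exact hv.continuous.comp continuous_snd
  | succ j ih =>
    refine continuous_finsetSum _ fun i _ => Continuous.mul ?_ (ih (contDiff_partialD hv i))
    fun_prop

/-- Each order contributes a sum over three coordinates with |z_i| ≤ ‖z‖, hence a factor 3‖z‖. The
shift α ↦ α + e_i is injective from order j into order j + 1, so no multi-index is counted twice for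
a given i. -/
theorem abs_dirPow_le (z : E3) (j : ℕ) {v : E3 → ℝ} (hv : ContDiff ℝ ∞ v) (ξ : E3) :
    |dirPow z j v ξ| ≤ (3 * ‖z‖) ^ j * ∑ α ∈ topIndices j, |multiD α v ξ| := by
  induction j generalizing v with
  | zero =>
    simp only [dirPow, pow_zero, one_mul]
    exact Finset.single_le_sum (f := fun α => |multiD α v ξ|) (fun _ _ => abs_nonneg _)
      (mem_topIndices.2 (by simp : ∑ i, (0 : Fin 3 → ℕ) i = 0))
  | succ j ih =>
    have hstep : ∀ i : Fin 3, ∑ α ∈ topIndices j, |multiD α (partialD i v) ξ| ≤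
        ∑ α ∈ topIndices (j + 1), |multiD α v ξ| := by
      intro i
      simp only [multiD_partialD hv]
      have hinj : Set.InjOn (fun α : Fin 3 → ℕ => α + Pi.single i 1) (topIndices j) :=
        fun a _ b _ h => by simpa using h
      rw [← Finset.sum_image (f := fun α => |multiD α v ξ|) hinj]
      refine Finset.sum_le_sum_of_subset_of_nonneg ?_ fun _ _ _ => abs_nonneg _
      intro β hβ
      obtain ⟨α, hα, rfl⟩ := Finset.mem_image.1 hβ
      rw [mem_topIndices] at *
      simp [Finset.sum_add_distrib, hα]
    have hz : ∀ i, |z i| ≤ ‖z‖ := fun i => by simpa using PiLp.norm_apply_le z i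
    calc |dirPow z (j + 1) v ξ| ≤ ∑ i, |z i * dirPow z j (partialD i v) ξ| :=
          Finset.abs_sum_le_sum_abs _ _
      _ ≤ ∑ _i : Fin 3, ‖z‖ * ((3 * ‖z‖) ^ j * ∑ α ∈ topIndices (j + 1), |multiD α v ξ|) := by
          refine Finset.sum_le_sum fun i _ => ?_
          rw [abs_mul]
          gcongr
          · exact hz i
          · exact (ih (contDiff_partialD hv i)).trans (by gcongr; exact hstep i)
      _ = _ := by simp; ring

/-- The Taylor polynomial of order `m` (degree at most `m - 1`) of `v` at `y`, evaluated at `x`. -/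
def taylorAt (m : ℕ) (v : E3 → ℝ) (y x : E3) : ℝ :=
  ∑ j ∈ Finset.range m, ((j.factorial : ℝ))⁻¹ * dirPow (x - y) j v y

theorem continuous_taylorAt (m : ℕ) {v : E3 → ℝ} (hv : ContDiff ℝ ∞ v) :
    Continuous fun q : E3 × E3 => taylorAt m v q.1 q.2 := by
  refine continuous_finsetSum _ fun j _ => continuous_const.mul ?_
  exact (continuous_dirPow j hv).comp
    ((continuous_snd.sub continuous_fst).prodMk continuous_fst)

/-- The centre of expansion moves along the segment from x (s = 0) to y (s = 1) while the evaluation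
point x stays fixed. The derivative in s telescopes and leaves only the top-order term. Its weight
s^m later absorbs the Jacobian of the homothety y ↦ x - s(x - y). -/
theorem sub_taylorAt_eq_integral (m : ℕ) {v : E3 → ℝ} (hv : ContDiff ℝ ∞ v) (x y : E3) :
    v x - taylorAt (m + 1) v y x =
      ∫ s in (0 : ℝ)..1, s ^ m * ((m.factorial : ℝ))⁻¹ * dirPow (x - y) (m + 1) v (x - s • (x - y)) := by
  set z := x - y
  set F : ℕ → ℝ → ℝ := fun n s => ∑ j ∈ Finset.range n,
    s ^ j * ((j.factorial : ℝ))⁻¹ * dirPow z j v (x - s • z) with hF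
  have hder : ∀ n s, HasDerivAt (F (n + 1))
      (-(s ^ n * ((n.factorial : ℝ))⁻¹ * dirPow z (n + 1) v (x - s • z))) s := by
    intro n s
    induction n with
    | zero =>
      have := hasDerivAt_dirPow z x 0 hv s
      simpa [hF] using this
    | succ n ih =>
      have h1 := ((hasDerivAt_pow (n + 1) s).mul_const (((n + 1).factorial : ℝ))⁻¹).mul
        (hasDerivAt_dirPow z x (n + 1) hv s)
      have h2 := ih.add h1
      have h3 : F (n + 1 + 1) = F (n + 1) + (fun s : ℝ => s ^ (n + 1) * ((n + 1).factorial : ℝ)⁻¹) *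
          fun s : ℝ => dirPow z (n + 1) v (x - s • z) := by
        funext s
        simp [hF, Finset.sum_range_succ _ (n + 1)]
      rw [h3]
      refine h2.congr_deriv ?_
      have : ((n.factorial : ℝ)) ≠ 0 := by positivity
      rw [Nat.factorial_succ]
      push_cast
      field_simp
      simp
  have hc : Continuous fun s : ℝ =>
      -(s ^ m * ((m.factorial : ℝ))⁻¹ * dirPow z (m + 1) v (x - s • z)) := by
    have : Continuous fun s : ℝ => dirPow z (m + 1) v (x - s • z) :=
      (continuous_dirPow (m + 1) hv).comp
        (continuous_const.prodMk (by fun_prop : Continuous fun s : ℝ => x - s • z))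
    fun_prop
  have hintg := intervalIntegral.integral_eq_sub_of_hasDerivAt (a := 0) (b := 1)
    (fun s _ => hder m s) (hc.intervalIntegrable 0 1)
  have h1 : F (m + 1) 1 = taylorAt (m + 1) v y x := by
    simp [hF, taylorAt, z]
  have h0 : F (m + 1) 0 = v x := by
    simp [hF, Finset.sum_range_succ', dirPow]
  rw [h0, h1, intervalIntegral.integral_neg] at hintg
  linarith

theorem exists_polyEval_eq_dirPow (ℓ : Fin 3 → Poly3) (hℓ : ∀ i, (ℓ i).totalDegree ≤ 1) (z : E3 → E3)
    (hz : ∀ x i, z x i = polyEval (ℓ i) x) (j : ℕ) (v : E3 → ℝ) (y : E3) :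
    ∃ q ∈ polySpace j, ∀ x, dirPow (z x) j v y = polyEval q x := by
  induction j generalizing v with
  | zero => exact ⟨MvPolynomial.C (v y), by simp [MvPolynomial.mem_restrictTotalDegree],
      fun x => by simp [dirPow, polyEval]⟩
  | succ j ih =>
    choose q hq hqe using fun i => ih (partialD i v)
    refine ⟨∑ i, ℓ i * q i, Submodule.sum_mem _ fun i _ => ?_, fun x => ?_⟩
    · rw [MvPolynomial.mem_restrictTotalDegree]
      refine (MvPolynomial.totalDegree_mul _ _).trans ?_
      have h1 := hℓ i
      have h2 := (MvPolynomial.mem_restrictTotalDegree _ _ _).1 (hq i)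
      omega
    · simp only [dirPow, polyEval, map_sum, map_mul]
      exact Finset.sum_congr rfl fun i _ => by rw [hz, hqe]; rfl

theorem polySpace_mono {j k : ℕ} (h : j ≤ k) : polySpace j ≤ polySpace k := fun q hq => by
  rw [MvPolynomial.mem_restrictTotalDegree] at *
  exact hq.trans h

/-- Composition with an affine map does not raise the degree, so a Taylor polynomial taken on the
physical element is admissible in the exactness condition on the reference element. -/
theorem exists_polyEval_eq_taylorAt (ℓ : Fin 3 → Poly3) (hℓ : ∀ i, (ℓ i).totalDegree ≤ 1)
    (φ : E3 → E3) (hφ : ∀ x i, φ x i = polyEval (ℓ i) x) (m : ℕ) (v : E3 → ℝ) (y : E3) :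
    ∃ q ∈ polySpace m, ∀ x, taylorAt (m + 1) v y (φ x) = polyEval q x := by
  have h : ∀ j, ∃ q ∈ polySpace j, ∀ x, dirPow (φ x - y) j v y = polyEval q x := by
    intro j
    refine exists_polyEval_eq_dirPow (fun i => ℓ i - MvPolynomial.C (y i)) (fun i => ?_) _
      (fun x i => ?_) j v y
    · refine (MvPolynomial.totalDegree_sub _ _).trans ?_
      simpa using hℓ i
    · simp [polyEval, hφ]
  choose q hq hqe using h
  refine ⟨∑ j ∈ Finset.range (m + 1), ((j.factorial : ℝ))⁻¹ • q j,
    Submodule.sum_mem _ fun j hj => Submodule.smul_mem _ _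
      (polySpace_mono (Nat.lt_succ_iff.1 (Finset.mem_range.1 hj)) (hq j)), fun x => ?_⟩
  simp only [taylorAt, hqe, polyEval, map_sum, MvPolynomial.smul_eval]

end Taylor

/-! ### Behaviour of L² norms under homotheties. -/

section Homothety

theorem lintegral_image_smul_add {K : Set E3} (hK : MeasurableSet K) {t : ℝ} (ht : 0 < t) (b : E3)
    (F : E3 → ℝ≥0∞) :
    ∫⁻ y in (fun y : E3 => t • y + b) '' K, F y =
      ENNReal.ofReal (t ^ 3) * ∫⁻ y in K, F (t • y + b) := by
  have hd : ∀ y ∈ K, HasFDerivWithinAt (fun y : E3 => t • y + b)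
      (t • ContinuousLinearMap.id ℝ E3) K y := fun y _ =>
    (((hasFDerivAt_id y).const_smul t).add_const b).hasFDerivWithinAt
  have hinj : Set.InjOn (fun y : E3 => t • y + b) K := fun y _ z _ h => by
    simpa [ht.ne'] using h
  rw [lintegral_image_eq_lintegral_abs_det_fderiv_mul volume hK hd hinj]
  have hdet : (t • ContinuousLinearMap.id ℝ E3).det = t ^ 3 := by
    rw [ContinuousLinearMap.det]
    simp [LinearMap.det_smul]
  rw [hdet, abs_of_pos (by positivity), lintegral_const_mul' _ _ ENNReal.ofReal_ne_top]

/-- The Jacobian t³ becomes t^(-3/2) in the L² norm. This exponent is the reason why at least one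
power of s, hence m ≥ 1, is needed in the averaged Taylor estimate. -/
theorem eLpNorm_comp_smul_add_le {K K' : Set E3} (hK : MeasurableSet K) {t : ℝ} (ht : 0 < t)
    (b : E3) (hKK' : Set.MapsTo (fun y : E3 => t • y + b) K K') (f : E3 → ℝ) :
    eLpNorm (fun y => f (t • y + b)) 2 (volume.restrict K) ≤
      ENNReal.ofReal (t ^ (-(3 / 2) : ℝ)) * eLpNorm f 2 (volume.restrict K') := by
  simp only [eLpNorm_eq_lintegral_rpow_enorm_toReal (two_ne_zero) (ENNReal.ofNat_ne_top),
    ENNReal.toReal_ofNat]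
  have h1 := lintegral_image_smul_add hK ht b (fun y => ‖f y‖ₑ ^ (2 : ℝ))
  have h2 : ∫⁻ y in K, ‖f (t • y + b)‖ₑ ^ (2 : ℝ) ≤
      ENNReal.ofReal (t ^ (-3 : ℝ)) * ∫⁻ y in K', ‖f y‖ₑ ^ (2 : ℝ) := by
    calc ∫⁻ y in K, ‖f (t • y + b)‖ₑ ^ (2 : ℝ)
        = ENNReal.ofReal (t ^ (-3 : ℝ)) *
            (ENNReal.ofReal (t ^ 3) * ∫⁻ y in K, ‖f (t • y + b)‖ₑ ^ (2 : ℝ)) := by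
          rw [← mul_assoc, ← ENNReal.ofReal_mul (by positivity), ← Real.rpow_natCast,
            ← Real.rpow_add ht]
          norm_num
      _ ≤ _ := by
          rw [← h1]
          gcongr
          exact hKK'.image_subset
  calc _ ≤ (ENNReal.ofReal (t ^ (-3 : ℝ)) * ∫⁻ y in K', ‖f y‖ₑ ^ (2 : ℝ)) ^ (1 / (2 : ℝ)) := by
        gcongr
    _ = _ := by
        rw [ENNReal.mul_rpow_of_nonneg _ _ (by norm_num),
          ENNReal.ofReal_rpow_of_nonneg (by positivity) (by norm_num), ← Real.rpow_mul ht.le]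
        norm_num

end Homothety

/-! ### Averaged Taylor remainder and Sobolev inequality for smooth functions. -/

section SmoothEstimate

theorem lintegral_rpow_neg_half :
    ∫⁻ s in Set.Ioc (0 : ℝ) 1, ENNReal.ofReal (s ^ (-(1 / 2) : ℝ)) = 2 := by
  have hi : IntegrableOn (fun s : ℝ => s ^ (-(1 / 2) : ℝ)) (Set.Ioc 0 1) := by
    rw [← intervalIntegrable_iff_integrableOn_Ioc_of_le zero_le_one]
    exact intervalIntegral.intervalIntegrable_rpow' (by norm_num)
  rw [← ofReal_integral_eq_lintegral_ofReal hi, ← intervalIntegral.integral_of_le zero_le_one,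
    integral_rpow (Or.inl (by norm_num))]
  · norm_num
  · filter_upwards [self_mem_ae_restrict measurableSet_Ioc] with s hs
    exact Real.rpow_nonneg hs.1.le _

/-- The Taylor remainder at a point of a convex set, averaged over the centre of expansion. -/
theorem lintegral_sub_taylorAt_le {K : Set E3} (hK : Convex ℝ K) (hKm : MeasurableSet K) {x : E3}
    (hx : x ∈ K) {m : ℕ} (hm : 1 ≤ m) {d : ℝ} (hd : ∀ y ∈ K, ‖x - y‖ ≤ d) {v : E3 → ℝ}
    (hv : ContDiff ℝ ∞ v) :
    ∫⁻ y in K, ‖v x - taylorAt (m + 1) v y x‖ₑ ≤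
      ENNReal.ofReal ((3 * d) ^ (m + 1)) * 2 * (volume K) ^ (1 / 2 : ℝ) *
        ∑ α ∈ topIndices (m + 1), eLpNorm (multiD α v) 2 (volume.restrict K) := by
  have hd0 : 0 ≤ d := (norm_nonneg _).trans (hd x hx)
  set G : E3 → ℝ≥0∞ := fun ξ => ∑ α ∈ topIndices (m + 1), ‖multiD α v ξ‖ₑ with hG
  have hGc : Continuous G := continuous_finsetSum _ fun α _ => (contDiff_multiD hv α).continuous.enorm
  set c : ℝ → ℝ≥0∞ := fun s => ENNReal.ofReal (s ^ m * (3 * d) ^ (m + 1)) with hc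
  set N := ∑ α ∈ topIndices (m + 1), eLpNorm (multiD α v) 2 (volume.restrict K)
  have hpt : ∀ y ∈ K, ‖v x - taylorAt (m + 1) v y x‖ₑ ≤
      ∫⁻ s in Set.Ioc (0 : ℝ) 1, c s * G (x - s • (x - y)) := by
    intro y hy
    rw [sub_taylorAt_eq_integral m hv, intervalIntegral.integral_of_le zero_le_one]
    refine (enorm_integral_le_lintegral_enorm _).trans ?_
    refine setLIntegral_mono' measurableSet_Ioc fun s hs => ?_
    rw [hG, hc]
    simp only [Real.enorm_eq_ofReal_abs]
    rw [← ENNReal.ofReal_sum_of_nonneg fun _ _ => abs_nonneg _, ← ENNReal.ofReal_mul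
      (mul_nonneg (pow_nonneg hs.1.le _) (by positivity))]
    refine ENNReal.ofReal_le_ofReal ?_
    rw [abs_mul, abs_mul, abs_of_nonneg (pow_nonneg hs.1.le m), mul_assoc, mul_assoc]
    refine mul_le_mul_of_nonneg_left ?_ (pow_nonneg hs.1.le m)
    · have h1 : |((m.factorial : ℝ))⁻¹| ≤ 1 := by
        rw [abs_of_nonneg (by positivity)]
        exact inv_le_one_of_one_le₀ (by exact_mod_cast m.factorial_pos)
      calc |((m.factorial : ℝ))⁻¹| * |dirPow (x - y) (m + 1) v (x - s • (x - y))|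
          ≤ 1 * |dirPow (x - y) (m + 1) v (x - s • (x - y))| := by gcongr
        _ ≤ (3 * ‖x - y‖) ^ (m + 1) * ∑ α ∈ topIndices (m + 1),
              |multiD α v (x - s • (x - y))| := by
            rw [one_mul]; exact abs_dirPow_le _ _ hv _
        _ ≤ (3 * d) ^ (m + 1) * ∑ α ∈ topIndices (m + 1), |multiD α v (x - s • (x - y))| := by
            gcongr
            exact hd y hy
  -- For fixed s the map y ↦ x - s(x - y) is a homothety centred at x which sends K into K by
  -- convexity. Cauchy–Schwarz gives |K|^(1/2), the change of variables s^(-3/2).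
  have hin : ∀ s ∈ Set.Ioc (0 : ℝ) 1, ∫⁻ y in K, c s * G (x - s • (x - y)) ≤
      ENNReal.ofReal (s ^ (-(1 / 2) : ℝ)) *
        (ENNReal.ofReal ((3 * d) ^ (m + 1)) * (volume K) ^ (1 / 2 : ℝ) * N) := by
    intro s hs
    have hT : ∀ y, x - s • (x - y) = s • y + (1 - s) • x := fun y => by module
    have hmaps : Set.MapsTo (fun y : E3 => s • y + (1 - s) • x) K K := fun y hy =>
      hK hy hx hs.1.le (by linarith [hs.2]) (by ring)
    have hα : ∀ α ∈ topIndices (m + 1), ∫⁻ y in K, ‖multiD α v (x - s • (x - y))‖ₑ ≤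
        ENNReal.ofReal (s ^ (-(3 / 2) : ℝ)) * eLpNorm (multiD α v) 2 (volume.restrict K) *
          (volume K) ^ (1 / 2 : ℝ) := by
      intro α _
      simp only [hT]
      rw [← eLpNorm_one_eq_lintegral_enorm]
      have hcont : Continuous fun y : E3 => multiD α v (s • y + (1 - s) • x) :=
        (contDiff_multiD hv α).continuous.comp (by fun_prop)
      refine (eLpNorm_le_eLpNorm_mul_rpow_measure_univ (p := 1) (q := 2) (by norm_num)
        hcont.aestronglyMeasurable).trans ?_
      have : (1 / (1 : ℝ≥0∞).toReal - 1 / (2 : ℝ≥0∞).toReal) = 1 / 2 := by norm_num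
      rw [this, Measure.restrict_apply_univ]
      gcongr
      exact eLpNorm_comp_smul_add_le hKm hs.1 _ hmaps _
    rw [lintegral_const_mul' _ _ ENNReal.ofReal_ne_top, hG,
      lintegral_finsetSum' _ fun α _ => ?_]
    · calc _ ≤ c s * ∑ α ∈ topIndices (m + 1), ENNReal.ofReal (s ^ (-(3 / 2) : ℝ)) *
            eLpNorm (multiD α v) 2 (volume.restrict K) * (volume K) ^ (1 / 2 : ℝ) := by
            gcongr with α h
            exact hα α h
        _ = (ENNReal.ofReal (s ^ m) * ENNReal.ofReal (s ^ (-(3 / 2) : ℝ))) *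
              (ENNReal.ofReal ((3 * d) ^ (m + 1)) * (volume K) ^ (1 / 2 : ℝ) * N) := by
            rw [← Finset.sum_mul, ← Finset.mul_sum, hc]
            simp only
            rw [ENNReal.ofReal_mul (pow_nonneg hs.1.le _)]
            ring
        _ ≤ _ := by
            gcongr
            rw [← ENNReal.ofReal_mul (pow_nonneg hs.1.le _)]
            refine ENNReal.ofReal_le_ofReal ?_
            -- Since m ≥ 1 and s ≤ 1, the power is at most s^(-1/2), whose integral over (0, 1] is
            -- the factor 2 of the statement.
            calc s ^ m * s ^ (-(3 / 2) : ℝ) ≤ s ^ 1 * s ^ (-(3 / 2) : ℝ) := by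
                  refine mul_le_mul_of_nonneg_right (pow_le_pow_of_le_one hs.1.le hs.2 hm)
                    (Real.rpow_nonneg hs.1.le _)
              _ = s ^ (-(1 / 2) : ℝ) := by
                  rw [← Real.rpow_natCast, ← Real.rpow_add hs.1]; norm_num
    · have : Continuous fun y : E3 => multiD α v (x - s • (x - y)) :=
        (contDiff_multiD hv α).continuous.comp (by fun_prop)
      exact this.enorm.aemeasurable
  have hmeas : Measurable fun q : E3 × ℝ => c q.2 * G (x - q.2 • (x - q.1)) := by
    have h1 : Continuous fun q : E3 × ℝ => c q.2 :=
      ENNReal.continuous_ofReal.comp (by fun_prop)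
    have h2 : Continuous fun q : E3 × ℝ => G (x - q.2 • (x - q.1)) := hGc.comp (by fun_prop)
    exact h1.measurable.mul h2.measurable
  calc ∫⁻ y in K, ‖v x - taylorAt (m + 1) v y x‖ₑ
      ≤ ∫⁻ y in K, ∫⁻ s in Set.Ioc (0 : ℝ) 1, c s * G (x - s • (x - y)) :=
        setLIntegral_mono' hKm hpt
    _ = ∫⁻ s in Set.Ioc (0 : ℝ) 1, ∫⁻ y in K, c s * G (x - s • (x - y)) :=
        lintegral_lintegral_swap hmeas.aemeasurable
    _ ≤ ∫⁻ s in Set.Ioc (0 : ℝ) 1, ENNReal.ofReal (s ^ (-(1 / 2) : ℝ)) *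
          (ENNReal.ofReal ((3 * d) ^ (m + 1)) * (volume K) ^ (1 / 2 : ℝ) * N) :=
        setLIntegral_mono' measurableSet_Ioc hin
    _ = _ := by
        rw [lintegral_mul_const _ (by fun_prop), lintegral_rpow_neg_half]
        ring

/-- The Sobolev inequality `H² ⊂ C⁰` for smooth functions on a convex body. -/
theorem exists_enorm_le_sum_eLpNorm {K : Set E3} (hK : Convex ℝ K) (hKc : IsCompact K)
    (hK0 : volume K ≠ 0) :
    ∃ C : ℝ≥0∞, C ≠ ⊤ ∧ ∀ v : E3 → ℝ, ContDiff ℝ ∞ v → ∀ x ∈ K,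
      ‖v x‖ₑ ≤ C * ∑ α ∈ multiIndices 2, eLpNorm (multiD α v) 2 (volume.restrict K) := by
  obtain ⟨d, hd⟩ : ∃ d, ∀ x ∈ K, ∀ y ∈ K, ‖x - y‖ ≤ d :=
    ⟨Metric.diam K, fun x hx y hy => by
      rw [← dist_eq_norm]; exact Metric.dist_le_diam_of_mem hKc.isBounded hx hy⟩
  have hKm := hKc.measurableSet
  have hKfin : volume K ≠ ⊤ := hKc.measure_ne_top
  set A := ENNReal.ofReal ((3 * d) ^ 2) * 2 * (volume K) ^ (1 / 2 : ℝ) with hA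
  set B := ENNReal.ofReal (1 + 3 * d) * (volume K) ^ (1 / 2 : ℝ) with hB
  have hr : (volume K) ^ (1 / 2 : ℝ) ≠ ⊤ := ENNReal.rpow_ne_top_of_nonneg (by norm_num) hKfin
  have hAfin : A ≠ ⊤ := ENNReal.mul_ne_top (ENNReal.mul_ne_top ENNReal.ofReal_ne_top (by simp)) hr
  have hBfin : B ≠ ⊤ := ENNReal.mul_ne_top ENNReal.ofReal_ne_top hr
  refine ⟨(volume K)⁻¹ * (A + B), ENNReal.mul_ne_top (ENNReal.inv_ne_top.2 hK0)
    (ENNReal.add_ne_top.2 ⟨hAfin, hBfin⟩), fun v hv x hx => ?_⟩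
  have hd0 : 0 ≤ d := (norm_nonneg _).trans (hd x hx x hx)
  set N := ∑ α ∈ multiIndices 2, eLpNorm (multiD α v) 2 (volume.restrict K)
  have h1 : ∫⁻ y in K, ‖v x - taylorAt 2 v y x‖ₑ ≤ A * N := by
    refine (lintegral_sub_taylorAt_le hK hKm hx le_rfl (hd x hx) hv).trans ?_
    rw [← hA]
    gcongr
    exact Finset.sum_le_sum_of_subset (topIndices_subset le_rfl)
  -- The affine Taylor polynomial has a term of order 0, with factor 1, and a term of order 1, with
  -- factor 3d.
  have hT : ∀ y ∈ K, ‖taylorAt 2 v y x‖ₑ ≤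
      ENNReal.ofReal (1 + 3 * d) * ∑ α ∈ multiIndices 2, ‖multiD α v y‖ₑ := by
    intro y hy
    simp only [Real.enorm_eq_ofReal_abs]
    rw [← ENNReal.ofReal_sum_of_nonneg fun _ _ => abs_nonneg _, ← ENNReal.ofReal_mul
      (by positivity)]
    refine ENNReal.ofReal_le_ofReal ?_
    have hj : ∀ j ≤ 2, ∑ α ∈ topIndices j, |multiD α v y| ≤ ∑ α ∈ multiIndices 2, |multiD α v y| :=
      fun j hj => Finset.sum_le_sum_of_subset_of_nonneg (topIndices_subset hj)
        fun _ _ _ => abs_nonneg _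
    have e0 := (abs_dirPow_le (x - y) 0 hv y).trans
      (mul_le_mul_of_nonneg_left (hj 0 (by norm_num)) (by positivity))
    have e1 := (abs_dirPow_le (x - y) 1 hv y).trans
      (mul_le_mul_of_nonneg_left (hj 1 (by norm_num)) (by positivity))
    have hs : 0 ≤ ∑ α ∈ multiIndices 2, |multiD α v y| :=
      Finset.sum_nonneg fun _ _ => abs_nonneg _
    simp only [taylorAt, Finset.sum_range_succ, Finset.sum_range_zero, Nat.factorial]
    simp only [Nat.cast_one, mul_one, inv_one, one_mul, zero_add, pow_zero, pow_one] at *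
    refine (abs_add_le _ _).trans ?_
    have := mul_le_mul_of_nonneg_right (hd x hx y hy) hs
    nlinarith
  have h2 : ∫⁻ y in K, ‖taylorAt 2 v y x‖ₑ ≤ B * N := by
    refine (setLIntegral_mono' hKm hT).trans ?_
    rw [lintegral_const_mul' _ _ ENNReal.ofReal_ne_top, lintegral_finsetSum' _ fun α _ =>
      (contDiff_multiD hv α).continuous.enorm.aemeasurable, hB, mul_assoc]
    refine mul_le_mul' le_rfl ?_
    rw [Finset.mul_sum]
    refine Finset.sum_le_sum fun α _ => ?_
    rw [← eLpNorm_one_eq_lintegral_enorm]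
    refine (eLpNorm_le_eLpNorm_mul_rpow_measure_univ (p := 1) (q := 2) (by norm_num)
      (contDiff_multiD hv α).continuous.aestronglyMeasurable).trans ?_
    have : (1 / (1 : ℝ≥0∞).toReal - 1 / (2 : ℝ≥0∞).toReal) = 1 / 2 := by norm_num
    rw [this, Measure.restrict_apply_univ, mul_comm]
  -- The constant v x is integrated over the centre y and split into remainder and Taylor
  -- polynomial.
  have h3 : volume K * ‖v x‖ₑ ≤ (A + B) * N := by
    calc volume K * ‖v x‖ₑ = ∫⁻ _y in K, ‖v x‖ₑ := by simp [mul_comm]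
      _ ≤ ∫⁻ y in K, (‖v x - taylorAt 2 v y x‖ₑ + ‖taylorAt 2 v y x‖ₑ) := by
          refine lintegral_mono fun y => ?_
          simpa using enorm_add_le (v x - taylorAt 2 v y x) (taylorAt 2 v y x)
      _ = (∫⁻ y in K, ‖v x - taylorAt 2 v y x‖ₑ) + ∫⁻ y in K, ‖taylorAt 2 v y x‖ₑ := by
          refine lintegral_add_right _ ?_
          have : Continuous fun y => taylorAt 2 v y x :=
            (continuous_taylorAt 2 hv).comp (by fun_prop : Continuous fun y : E3 => (y, x))
          exact this.enorm.measurable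
      _ ≤ A * N + B * N := add_le_add h1 h2
      _ = _ := by ring
  calc ‖v x‖ₑ = (volume K)⁻¹ * (volume K * ‖v x‖ₑ) := by
        rw [← mul_assoc, ENNReal.inv_mul_cancel hK0 hKfin, one_mul]
    _ ≤ (volume K)⁻¹ * ((A + B) * N) := by gcongr
    _ = _ := by ring

end SmoothEstimate

/-! ### Derivatives and L² bounds of mollifications. -/

section Convolution

theorem hasCompactSupport_partialD {g : E3 → ℝ} (hg : HasCompactSupport g) (i : Fin 3) :
    HasCompactSupport (partialD i g) := by
  refine (hg.fderiv ℝ).mono' ?_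
  refine Function.support_subset_iff'.2 fun x hx => ?_
  have : fderiv ℝ g x = 0 := image_eq_zero_of_notMem_tsupport hx
  simp [partialD, this]

theorem partialD_convolution {f g : E3 → ℝ} (hf : LocallyIntegrable f volume)
    (hgs : HasCompactSupport g) (hg : ContDiff ℝ ∞ g) (i : Fin 3) :
    partialD i (f ⋆[ContinuousLinearMap.mul ℝ ℝ, volume] g) =
      f ⋆[ContinuousLinearMap.mul ℝ ℝ, volume] partialD i g := by
  have hg1 : ContDiff ℝ 1 g := hg.of_le (by exact_mod_cast le_top)
  funext x
  have h := hgs.hasFDerivAt_convolution_right (ContinuousLinearMap.mul ℝ ℝ) hf hg1 x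
  rw [partialD, h.fderiv, convolution_precompR_apply _ hf (hgs.fderiv ℝ)
    (hg1.continuous_fderiv one_ne_zero)]
  rfl

theorem multiD_convolution {f g : E3 → ℝ} (hf : LocallyIntegrable f volume)
    (hgs : HasCompactSupport g) (hg : ContDiff ℝ ∞ g) (α : Fin 3 → ℕ) :
    multiD α (f ⋆[ContinuousLinearMap.mul ℝ ℝ, volume] g) =
      f ⋆[ContinuousLinearMap.mul ℝ ℝ, volume] multiD α g := by
  have step : ∀ (i : Fin 3) (n : ℕ) {g : E3 → ℝ}, HasCompactSupport g → ContDiff ℝ ∞ g →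
      HasCompactSupport ((partialD i)^[n] g) ∧
      (partialD i)^[n] (f ⋆[ContinuousLinearMap.mul ℝ ℝ, volume] g) =
        f ⋆[ContinuousLinearMap.mul ℝ ℝ, volume] (partialD i)^[n] g := by
    intro i n g hgs hg
    induction n with
    | zero => exact ⟨hgs, rfl⟩
    | succ n ih =>
      simp only [Function.iterate_succ_apply']
      exact ⟨hasCompactSupport_partialD ih.1 i, by
        rw [ih.2, partialD_convolution hf ih.1 (contDiff_iterate_partialD hg i n)]⟩
  obtain ⟨s2, e2⟩ := step 2 (α 2) hgs hg
  obtain ⟨s1, e1⟩ := step 1 (α 1) s2 (contDiff_iterate_partialD hg _ _)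
  obtain ⟨-, e0⟩ := step 0 (α 0) s1
    (contDiff_iterate_partialD (contDiff_iterate_partialD hg _ _) _ _)
  unfold multiD
  rw [e2, e1, e0]

theorem convolution_normed_apply (φ : ContDiffBump (0 : E3)) (f : E3 → ℝ) (x : E3) :
    (f ⋆[ContinuousLinearMap.mul ℝ ℝ, volume] φ.normed volume) x =
      ∫ z, φ.normed volume z * f (x - z) := by
  rw [convolution_eq_swap]
  simp [mul_comm]

/-- Young's inequality for a probability density ρ: Cauchy–Schwarz with ρ = √ρ · √ρ gives |f ⋆ ρ|² ≤
|f|² ⋆ ρ, then Tonelli and translation invariance finish. -/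
theorem eLpNorm_convolution_normed_le (φ : ContDiffBump (0 : E3)) {f : E3 → ℝ}
    (hf : AEStronglyMeasurable f volume) :
    eLpNorm (f ⋆[ContinuousLinearMap.mul ℝ ℝ, volume] φ.normed volume) 2 volume ≤
      eLpNorm f 2 volume := by
  wlog hfm : StronglyMeasurable f generalizing f
  · rw [eLpNorm_congr_ae hf.ae_eq_mk, convolution_congr _ hf.ae_eq_mk (EventuallyEq.refl _ _)]
    exact this hf.stronglyMeasurable_mk.aestronglyMeasurable hf.stronglyMeasurable_mk
  set ρ : E3 → ℝ≥0∞ := fun z => ‖φ.normed volume z‖ₑ with hρ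
  have hρm : Measurable ρ := (φ.continuous_normed (μ := volume)).enorm.measurable
  have hρ1 : ∫⁻ z, ρ z = 1 := by
    rw [hρ]
    simp only [Real.enorm_eq_ofReal (φ.nonneg_normed _)]
    rw [← ofReal_integral_eq_lintegral_ofReal φ.integrable_normed
      (Eventually.of_forall φ.nonneg_normed), φ.integral_normed, ENNReal.ofReal_one]
  have hfe : Measurable fun y => ‖f y‖ₑ := hfm.measurable.enorm
  have hpt : ∀ x, ‖(f ⋆[ContinuousLinearMap.mul ℝ ℝ, volume] φ.normed volume) x‖ₑ ^ (2 : ℝ) ≤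
      ∫⁻ z, ρ z * ‖f (x - z)‖ₑ ^ (2 : ℝ) := by
    intro x
    have hxm : Measurable fun z => ‖f (x - z)‖ₑ := hfe.comp (measurable_const.sub measurable_id)
    have h1 : ‖(f ⋆[ContinuousLinearMap.mul ℝ ℝ, volume] φ.normed volume) x‖ₑ ≤
        ∫⁻ z, ρ z ^ (1 / 2 : ℝ) * (ρ z ^ (1 / 2 : ℝ) * ‖f (x - z)‖ₑ) := by
      rw [convolution_normed_apply]
      refine (enorm_integral_le_lintegral_enorm _).trans (lintegral_mono fun z => ?_)
      rw [enorm_mul, ← mul_assoc, ← ENNReal.rpow_add_of_nonneg _ _ (by norm_num) (by norm_num)]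
      norm_num [hρ]
    have h2 := ENNReal.lintegral_mul_le_Lp_mul_Lq volume Real.HolderConjugate.two_two
      (hρm.pow_const (1 / 2 : ℝ)).aemeasurable
      ((hρm.pow_const (1 / 2 : ℝ)).mul hxm).aemeasurable
    simp only [Pi.mul_apply] at h2
    have h3 : ∀ z, (ρ z ^ (1 / 2 : ℝ)) ^ (2 : ℝ) = ρ z := fun z => by
      rw [← ENNReal.rpow_mul]; norm_num
    simp only [h3, hρ1, ENNReal.one_rpow, one_mul,
      ENNReal.mul_rpow_of_nonneg _ _ (zero_le_two : (0 : ℝ) ≤ 2)] at h2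
    calc _ ≤ ((∫⁻ z, ρ z * ‖f (x - z)‖ₑ ^ (2 : ℝ)) ^ (1 / 2 : ℝ)) ^ (2 : ℝ) := by
          gcongr
          exact h1.trans h2
      _ = _ := by rw [← ENNReal.rpow_mul]; norm_num
  simp only [eLpNorm_eq_lintegral_rpow_enorm_toReal (two_ne_zero) (ENNReal.ofNat_ne_top),
    ENNReal.toReal_ofNat]
  gcongr ?_ ^ _
  calc _ ≤ ∫⁻ x, ∫⁻ z, ρ z * ‖f (x - z)‖ₑ ^ (2 : ℝ) := lintegral_mono hpt
    _ = ∫⁻ z, ∫⁻ x, ρ z * ‖f (x - z)‖ₑ ^ (2 : ℝ) := by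
        refine lintegral_lintegral_swap (Measurable.aemeasurable ?_)
        exact (hρm.comp measurable_snd).mul
          ((hfe.comp (measurable_fst.sub measurable_snd)).pow_const _)
    _ = ∫⁻ z, ρ z * ∫⁻ x, ‖f x‖ₑ ^ (2 : ℝ) := by
        refine lintegral_congr fun z => ?_
        rw [lintegral_const_mul' _ _ (by simp [hρ]),
          lintegral_sub_right_eq_self (fun x => ‖f x‖ₑ ^ (2 : ℝ)) z]
    _ = _ := by rw [lintegral_mul_const _ hρm, hρ1, one_mul]

end Convolution

/-! ### Mollification combined with a contraction, and its convergence in L². -/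

section Smoothing

/-- The contraction factors `tₙ → 1`. -/
def shrink (n : ℕ) : ℝ := 1 - 1 / (n + 2)

theorem shrink_ge (n : ℕ) : 1 / 2 ≤ shrink n := by
  have : (1 : ℝ) / (n + 2) ≤ 1 / 2 :=
    one_div_le_one_div_of_le (by norm_num) (by linarith [(Nat.cast_nonneg n : (0 : ℝ) ≤ n)])
  unfold shrink; linarith

theorem shrink_lt_one (n : ℕ) : shrink n < 1 := by
  have : (0 : ℝ) < 1 / (n + 2) := by positivity
  unfold shrink; linarith

theorem tendsto_shrink : Tendsto shrink atTop (𝓝 1) := by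
  have h : Tendsto (fun n : ℕ => (1 : ℝ) / ((n : ℝ) + 2)) atTop (𝓝 0) :=
    tendsto_const_nhds.div_atTop (tendsto_natCast_atTop_atTop.atTop_add tendsto_const_nhds)
  have hsub := (tendsto_const_nhds (x := (1 : ℝ))).sub h
  rwa [sub_zero] at hsub

/-- The bump function supported in the ball of radius `(1 - tₙ) δ`. -/
def shrinkBump {δ : ℝ} (hδ : 0 < δ) (n : ℕ) : ContDiffBump (0 : E3) where
  rIn := (1 - shrink n) * δ / 2
  rOut := (1 - shrink n) * δ
  rIn_pos := by have := shrink_lt_one n; have : 0 < 1 - shrink n := by linarith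
                positivity
  rIn_lt_rOut := by have := shrink_lt_one n; have : 0 < 1 - shrink n := by linarith
                    exact half_lt_self (by positivity)

/-- Mollification followed by a contraction towards `c`. -/
def smoothing (c : E3) {δ : ℝ} (hδ : 0 < δ) (n : ℕ) (f : E3 → ℝ) (x : E3) : ℝ :=
  (f ⋆[ContinuousLinearMap.mul ℝ ℝ, volume] (shrinkBump hδ n).normed volume)
    (shrink n • x + (1 - shrink n) • c)

variable (c : E3) {δ : ℝ} (hδ : 0 < δ)

theorem contDiff_smoothing (n : ℕ) {f : E3 → ℝ} (hf : LocallyIntegrable f volume) :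
    ContDiff ℝ ∞ (smoothing c hδ n f) := by
  have h := (shrinkBump hδ n).hasCompactSupport_normed (μ := volume).contDiff_convolution_right
    (ContinuousLinearMap.mul ℝ ℝ) hf ((shrinkBump hδ n).contDiff_normed (n := ⊤))
  exact h.comp (by fun_prop)

theorem smoothing_sub (n : ℕ) {f g : E3 → ℝ} (hf : LocallyIntegrable f volume)
    (hg : LocallyIntegrable g volume) (x : E3) :
    smoothing c hδ n (f - g) x = smoothing c hδ n f x - smoothing c hδ n g x := by
  set φ := shrinkBump hδ n
  have key : ∀ {f : E3 → ℝ}, LocallyIntegrable f volume →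
      ConvolutionExists f (φ.normed volume) (ContinuousLinearMap.mul ℝ ℝ) volume := fun hf =>
    φ.hasCompactSupport_normed.convolutionExists_right _ hf φ.continuous_normed
  simp only [smoothing, convolution_def]
  rw [← integral_sub (key hf _) (key hg _)]
  simp [φ]

/-- What matters is that the bound is uniform in n. The contraction costs t^(-3/2) with t ≥ 1/2,
which is less than 4. -/
theorem eLpNorm_smoothing_le (n : ℕ) {f : E3 → ℝ} (hf : AEStronglyMeasurable f volume) :
    eLpNorm (smoothing c hδ n f) 2 volume ≤ 4 * eLpNorm f 2 volume := by
  have ht : 0 < shrink n := by linarith [shrink_ge n]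
  have h := eLpNorm_comp_smul_add_le MeasurableSet.univ ht ((1 - shrink n) • c)
    (Set.mapsTo_univ _ Set.univ)
    (f ⋆[ContinuousLinearMap.mul ℝ ℝ, volume] (shrinkBump hδ n).normed volume)
  simp only [Measure.restrict_univ] at h
  refine h.trans (mul_le_mul' ?_ (eLpNorm_convolution_normed_le _ hf))
  rw [show (4 : ℝ≥0∞) = ENNReal.ofReal 4 by simp]
  refine ENNReal.ofReal_le_ofReal ?_
  calc shrink n ^ (-(3 / 2) : ℝ) ≤ (1 / 2 : ℝ) ^ (-(3 / 2) : ℝ) :=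
        Real.rpow_le_rpow_of_nonpos (by norm_num) (shrink_ge n) (by norm_num)
    _ ≤ (1 / 2 : ℝ) ^ (-2 : ℝ) :=
        Real.rpow_le_rpow_of_exponent_ge (by norm_num) (by norm_num) (by norm_num)
    _ = 4 := by
        rw [show (-2 : ℝ) = ((-2 : ℤ) : ℝ) by norm_num, Real.rpow_intCast]; norm_num

theorem eventually_abs_smoothing_sub_le {K : Set E3} (hK : Bornology.IsBounded K) {g : E3 → ℝ}
    (hgc : Continuous g) (hgs : HasCompactSupport g) {η : ℝ} (hη : 0 < η) :
    ∀ᶠ n in atTop, ∀ x ∈ K, |smoothing c hδ n g x - g x| ≤ η := by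
  obtain ⟨κ, hκ, hκg⟩ := Metric.uniformContinuous_iff.1
    (hgs.uniformContinuous_of_continuous hgc) (η / 2) (by positivity)
  obtain ⟨D, hD⟩ := hK.subset_closedBall c
  -- The contraction moves a point of K by at most (1 - t)|D| and the mollifier reaches (1 - t)δ
  -- further; both must stay below the modulus κ.
  have hlim : Tendsto (fun n => (1 - shrink n) * (|D| + δ)) atTop (𝓝 0) := by
    simpa using ((tendsto_const_nhds (x := (1 : ℝ))).sub tendsto_shrink).mul_const (|D| + δ)
  filter_upwards [hlim.eventually (gt_mem_nhds hκ)] with n hn x hx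
  have ht : 0 < 1 - shrink n := by linarith [shrink_lt_one n]
  set X := shrink n • x + (1 - shrink n) • c with hX
  have hXx : dist X x < κ := by
    have : X - x = (1 - shrink n) • (c - x) := by rw [hX]; module
    rw [dist_eq_norm, this, norm_smul, Real.norm_of_nonneg ht.le, ← dist_eq_norm, dist_comm]
    refine lt_of_le_of_lt ?_ hn
    gcongr
    have := (Metric.mem_closedBall.1 (hD hx)).trans (le_abs_self D)
    linarith
  have h1 : dist (smoothing c hδ n g x) (g X) ≤ η / 2 := by
    have h := (shrinkBump hδ n).dist_normed_convolution_le (μ := volume) (g := g) (x₀ := X)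
      (ε := η / 2) hgc.aestronglyMeasurable (fun y hy => (hκg (lt_of_lt_of_le
        (Metric.mem_ball.1 hy) ?_)).le)
    · convert h using 2
      simp only [smoothing]
      rw [convolution_normed_apply]
      rfl
    · refine le_trans ?_ hn.le
      change (1 - shrink n) * δ ≤ _
      gcongr
      linarith [abs_nonneg D]
  have h2 : dist (g X) (g x) ≤ η / 2 := (hκg hXx).le
  rw [← Real.dist_eq]
  linarith [dist_triangle (smoothing c hδ n g x) (g X) (g x)]

/-- Density argument: f is replaced by a continuous compactly supported g, for which convergence is
uniform on K. The uniform L² bound controls the smoothing of f - g. -/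
theorem tendsto_eLpNorm_smoothing_sub {K : Set E3} (hK : IsCompact K) {f : E3 → ℝ}
    (hf : MemLp f 2 volume) :
    Tendsto (fun n => eLpNorm (fun x => smoothing c hδ n f x - f x) 2 (volume.restrict K))
      atTop (𝓝 0) := by
  have hloc : ∀ {h : E3 → ℝ}, MemLp h 2 volume → LocallyIntegrable h volume := fun hh =>
    hh.locallyIntegrable (by norm_num)
  rw [ENNReal.tendsto_nhds_zero]
  intro ε hε
  -- The total 6 is 4 for the smoothed difference f - g, 1 for g itself and 1 for f - g.
  obtain ⟨ε', hε', hlt⟩ : ∃ ε' : ℝ≥0∞, 0 < ε' ∧ 6 * ε' ≤ ε := by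
    refine ⟨ε / 6, ENNReal.div_pos hε.ne' (by norm_num), ?_⟩
    rw [ENNReal.mul_div_cancel (by norm_num) (by norm_num)]
  obtain ⟨g, hgs, hfg, hgc, hg⟩ := hf.exists_hasCompactSupport_eLpNorm_sub_le (by norm_num) hε'.ne'
  obtain ⟨η, hη, hηK⟩ : ∃ η : ℝ, 0 < η ∧ (volume K) ^ (1 / 2 : ℝ) * ENNReal.ofReal η ≤ ε' := by
    have h : Tendsto (fun η : ℝ => (volume K) ^ (1 / 2 : ℝ) * ENNReal.ofReal η) (𝓝[>] 0)
        (𝓝 ((volume K) ^ (1 / 2 : ℝ) * ENNReal.ofReal 0)) :=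
      ENNReal.Tendsto.const_mul
        ((ENNReal.continuous_ofReal.tendsto 0).mono_left nhdsWithin_le_nhds)
        (Or.inr (ENNReal.rpow_ne_top_of_nonneg (by norm_num) hK.measure_ne_top))
    simp only [ENNReal.ofReal_zero, mul_zero] at h
    obtain ⟨η, h1, h2⟩ := ((h.eventually (gt_mem_nhds hε')).and self_mem_nhdsWithin).exists
    exact ⟨η, h2, h1.le⟩
  filter_upwards [eventually_abs_smoothing_sub_le c hδ hK.isBounded hgc hgs hη] with n hn
  have hsplit : (fun x => smoothing c hδ n f x - f x) =
      (smoothing c hδ n (f - g) + fun x => smoothing c hδ n g x - g x) + -(f - g) := by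
    funext x
    simp only [Pi.add_apply, Pi.neg_apply, smoothing_sub c hδ n (hloc hf) (hloc hg), Pi.sub_apply]
    ring
  have hm1 : AEStronglyMeasurable (smoothing c hδ n (f - g)) (volume.restrict K) :=
    (contDiff_smoothing c hδ n (hloc (hf.sub hg))).continuous.aestronglyMeasurable
  have hm2 : AEStronglyMeasurable (fun x => smoothing c hδ n g x - g x) (volume.restrict K) :=
    ((contDiff_smoothing c hδ n (hloc hg)).continuous.sub hgc).aestronglyMeasurable
  have hm3 : AEStronglyMeasurable (-(f - g)) (volume.restrict K) :=
    (hf.sub hg).1.neg.restrict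
  have b1 : eLpNorm (smoothing c hδ n (f - g)) 2 (volume.restrict K) ≤ 4 * ε' :=
    (eLpNorm_restrict_le _ _ _ _).trans ((eLpNorm_smoothing_le c hδ n (hf.sub hg).1).trans
      (by gcongr))
  have b2 : eLpNorm (fun x => smoothing c hδ n g x - g x) 2 (volume.restrict K) ≤ ε' := by
    refine (eLpNorm_le_of_ae_bound (C := η) ?_).trans ?_
    · filter_upwards [self_mem_ae_restrict hK.measurableSet] with x hx
      exact hn x hx
    · simpa using hηK
  have b3 : eLpNorm (-(f - g)) 2 (volume.restrict K) ≤ ε' := by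
    rw [eLpNorm_neg]
    exact (eLpNorm_restrict_le _ _ _ _).trans hfg
  rw [hsplit]
  calc _ ≤ (4 * ε' + ε') + ε' := (eLpNorm_add_le (hm1.add hm2) hm3 (by norm_num)).trans
        (add_le_add ((eLpNorm_add_le hm1 hm2 (by norm_num)).trans (add_le_add b1 b2)) b3)
    _ = 6 * ε' := by ring
    _ ≤ ε := hlt

end Smoothing

/-! ### Weak derivatives: uniqueness and mollification. -/

section WeakDerivative

theorem weakD_spec {k : ℕ} {O : Set E3} {u : E3 → ℝ} (h : MemSobolev k O u) {α : Fin 3 → ℕ}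
    (hα : α ∈ multiIndices k) :
    MemLp (weakD O α u) 2 (volume.restrict O) ∧ IsWeakDeriv O α u (weakD O α u) := by
  unfold weakD
  rw [dif_pos (h α hα)]
  exact (h α hα).choose_spec

theorem weakD_spec_of_exists {O : Set E3} {u v : E3 → ℝ} {α : Fin 3 → ℕ}
    (hv : MemLp v 2 (volume.restrict O)) (h : IsWeakDeriv O α u v) :
    MemLp (weakD O α u) 2 (volume.restrict O) ∧ IsWeakDeriv O α u (weakD O α u) := by
  have hex : ∃ v, MemLp v 2 (volume.restrict O) ∧ IsWeakDeriv O α u v := ⟨v, hv, h⟩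
  unfold weakD
  rw [dif_pos hex]
  exact hex.choose_spec

theorem integrable_mul_of_tsupport_subset {O : Set E3} {v φ : E3 → ℝ}
    (hv : LocallyIntegrableOn v O) (hφ : Continuous φ) (hc : HasCompactSupport φ)
    (hO : tsupport φ ⊆ O) : Integrable (fun x => v x * φ x) := by
  have h1 : IntegrableOn v (tsupport φ) := hv.integrableOn_compact_subset hO hc
  have h2 : IntegrableOn (fun x => v x * φ x) (tsupport φ) :=
    h1.mul_continuousOn hφ.continuousOn hc
  refine (integrableOn_iff_integrable_of_support_subset ?_).1 h2
  intro x hx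
  refine subset_tsupport _ ?_
  intro h0
  exact hx (by simp [h0])

theorem setIntegral_mul_of_tsupport_subset {O : Set E3} {v φ : E3 → ℝ} (hO : tsupport φ ⊆ O) :
    ∫ x in O, v x * φ x = ∫ x, v x * φ x := by
  refine setIntegral_eq_integral_of_forall_compl_eq_zero fun x hx => ?_
  rw [image_eq_zero_of_notMem_tsupport fun h => hx (hO h), mul_zero]

/-- Fundamental lemma of the calculus of variations. It identifies the chosen `weakD` with any
derivative computed by hand. -/
theorem IsWeakDeriv.ae_eq {O : Set E3} (hO : IsOpen O) {α : Fin 3 → ℕ} {u v w : E3 → ℝ}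
    (hv : IsWeakDeriv O α u v) (hw : IsWeakDeriv O α u w) : v =ᵐ[volume.restrict O] w := by
  have h := hO.ae_eq_zero_of_integral_contDiff_smul_eq_zero (f := fun x => v x - w x)
    (μ := volume) (hv.2.1.sub hw.2.1) fun φ hφ hc ht => by
      have e1 := hv.2.2 φ hφ hc ht
      rw [hw.2.2 φ hφ hc ht] at e1
      have e2 := mul_left_cancel₀ (pow_ne_zero _ (by norm_num : (-1 : ℝ) ≠ 0)) e1
      rw [setIntegral_mul_of_tsupport_subset ht, setIntegral_mul_of_tsupport_subset ht] at e2
      have i1 := integrable_mul_of_tsupport_subset hv.2.1 hφ.continuous hc ht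
      have i2 := integrable_mul_of_tsupport_subset hw.2.1 hφ.continuous hc ht
      simp only [smul_eq_mul, mul_comm (φ _), sub_mul]
      rw [integral_sub i1 i2, e2, sub_self]
  rw [EventuallyEq, ae_restrict_iff' hO.measurableSet]
  filter_upwards [h] with x hx hxO
  linarith [hx hxO]

theorem isWeakDeriv_zero {O : Set E3} {u : E3 → ℝ} (hu : LocallyIntegrableOn u O) :
    IsWeakDeriv O 0 u u := ⟨hu, hu, fun φ _ _ _ => by simp [multiD_zero]⟩

theorem weakD_zero_ae_eq {O : Set E3} (hO : IsOpen O) {u : E3 → ℝ}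
    (hu : MemLp u 2 (volume.restrict O)) : weakD O 0 u =ᵐ[volume.restrict O] u := by
  have hloc : LocallyIntegrableOn u O :=
    locallyIntegrableOn_of_locallyIntegrable_restrict (hu.locallyIntegrable (by norm_num))
  have h0 := isWeakDeriv_zero hloc
  exact (weakD_spec_of_exists hu h0).2.ae_eq hO h0

/-- The test function is w ↦ g (X - w). The reflection produces the sign (-1)^|α|, which cancels the
sign in the definition of the weak derivative. The hypothesis on X keeps the support inside O, so
the jump of the zero extension is never seen. -/
theorem convolution_multiD_eq {O : Set E3} (hO : MeasurableSet O) {α : Fin 3 → ℕ} {u v g : E3 → ℝ}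
    (h : IsWeakDeriv O α u v) (hg : ContDiff ℝ ∞ g) (hgs : HasCompactSupport g) {X : E3}
    (hX : ∀ w, X - w ∈ tsupport g → w ∈ O) :
    (O.indicator u ⋆[ContinuousLinearMap.mul ℝ ℝ, volume] multiD α g) X =
      (O.indicator v ⋆[ContinuousLinearMap.mul ℝ ℝ, volume] g) X := by
  set φ : E3 → ℝ := fun w => 1 * g ((-1 : ℝ) • w + X) with hφdef
  have hφe : ∀ w, φ w = g (X - w) := fun w => by
    simp only [hφdef, one_mul]; congr 1; module
  have hφ : ContDiff ℝ ∞ φ := contDiff_const.mul (hg.comp (by fun_prop))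
  have hφ' : φ = g ∘ Homeomorph.subLeft X := by
    funext w; rw [hφe]; rfl
  have hcs : HasCompactSupport φ := by
    rw [hφ']; exact hgs.comp_homeomorph _
  have hts : tsupport φ ⊆ O := by
    intro w hw
    rw [hφ', tsupport_comp_eq_preimage] at hw
    exact hX w hw
  have hD : ∀ w, multiD α φ w = (-1) ^ (∑ i, α i) * multiD α g (X - w) := by
    intro w
    rw [hφdef, multiD_const_mul_comp hg, one_mul]
    have e : (-1 : ℝ) • w + X = X - w := by module
    simp only [e]
  have key := h.2.2 φ hφ hcs hts
  simp only [hD, hφe] at key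
  have hind : ∀ (f q : E3 → ℝ), (O.indicator f ⋆[ContinuousLinearMap.mul ℝ ℝ, volume] q) X =
      ∫ w in O, f w * q (X - w) := by
    intro f q
    rw [convolution_def, ← integral_indicator hO]
    refine integral_congr_ae (Eventually.of_forall fun w => ?_)
    by_cases hw : w ∈ O <;> simp [hw]
  rw [hind, hind]
  have e : ∀ w, u w * ((-1) ^ (∑ i, α i) * multiD α g (X - w)) =
      (-1) ^ (∑ i, α i) * (u w * multiD α g (X - w)) := fun w => by ring
  simp only [e] at key
  rw [integral_const_mul] at key
  exact mul_left_cancel₀ (pow_ne_zero _ (by norm_num : (-1 : ℝ) ≠ 0)) key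

end WeakDerivative

/-! ### Smooth approximation up to the boundary of a convex body. -/

section Approximation

theorem restrict_interior_eq {K : Set E3} (hK : Convex ℝ K) :
    volume.restrict (interior K) = (volume.restrict K : Measure E3) := by
  refine Measure.restrict_congr_set ?_
  exact interior_ae_eq_of_null_frontier (hK.addHaar_frontier volume)

/-- A convex set with nonempty interior lies in the closure of that interior, so continuity carries
the equality to the boundary. This fixes the values of `contRep` at quadrature points lying on
faces. -/
theorem eqOn_of_ae_eq_restrict {K : Set E3} (hK : Convex ℝ K)
    (hKi : (interior K).Nonempty) {f g : E3 → ℝ} (hf : ContinuousOn f K) (hg : ContinuousOn g K)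
    (h : f =ᵐ[volume.restrict K] g) : Set.EqOn f g K := by
  have h1 : Set.EqOn f g (interior K) := by
    refine Measure.eqOn_open_of_ae_eq (μ := volume) ?_ isOpen_interior (hf.mono interior_subset)
      (hg.mono interior_subset)
    rw [restrict_interior_eq hK]; exact h
  refine h1.of_subset_closure hf hg interior_subset ?_
  rw [hK.closure_interior_eq_closure_of_nonempty_interior hKi]
  exact subset_closure

theorem contRep_spec {K : Set E3} {u g : E3 → ℝ} (hg : ContinuousOn g K)
    (h : g =ᵐ[volume.restrict K] u) :
    ContinuousOn (contRep K u) K ∧ contRep K u =ᵐ[volume.restrict K] u := by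
  have hex : ∃ g : E3 → ℝ, ContinuousOn g K ∧ g =ᵐ[volume.restrict K] u := ⟨g, hg, h⟩
  unfold contRep
  rw [dif_pos hex]
  exact hex.choose_spec

theorem contRep_eqOn {K : Set E3} (hK : Convex ℝ K)
    (hKi : (interior K).Nonempty) {u g : E3 → ℝ} (hg : ContinuousOn g K)
    (h : g =ᵐ[volume.restrict K] u) : Set.EqOn (contRep K u) g K := by
  obtain ⟨h1, h2⟩ := contRep_spec hg h
  exact eqOn_of_ae_eq_restrict hK hKi h1 hg (h2.trans h.symm)

/-- A Sobolev function of order at least two on a convex body is approximated, together with its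
weak derivatives in `L²` and uniformly on the closed body, by smooth functions. -/
theorem exists_smooth_approx {K : Set E3} (hK : Convex ℝ K) (hKc : IsCompact K)
    (hKi : (interior K).Nonempty) {k : ℕ} (hk : 2 ≤ k) {u : E3 → ℝ}
    (hu2 : MemLp u 2 (volume.restrict (interior K))) (hu : MemSobolev k (interior K) u) :
    (ContinuousOn (contRep K u) K ∧ contRep K u =ᵐ[volume.restrict K] u) ∧
    ∃ v : ℕ → E3 → ℝ, (∀ n, ContDiff ℝ ∞ (v n)) ∧
      TendstoUniformlyOn v (contRep K u) atTop K ∧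
      ∀ α ∈ multiIndices k, Tendsto (fun n => eLpNorm (fun x => multiD α (v n) x -
        weakD (interior K) α u x) 2 (volume.restrict K)) atTop (𝓝 0) := by
  set O := interior K with hOdef
  have hO : IsOpen O := isOpen_interior
  have hres : volume.restrict O = (volume.restrict K : Measure E3) := restrict_interior_eq hK
  have hKm := hKc.measurableSet
  obtain ⟨c, hc⟩ := hKi
  obtain ⟨δ, hδ, hball⟩ := Metric.nhds_basis_closedBall.mem_iff.1 (hO.mem_nhds hc)
  have hK0 : volume K ≠ 0 := (lt_of_lt_of_le (hO.measure_pos volume ⟨c, hc⟩)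
    (measure_mono interior_subset)).ne'
  have hmem : ∀ {f : E3 → ℝ}, MemLp f 2 (volume.restrict O) → MemLp (O.indicator f) 2 volume :=
    fun hf => (memLp_indicator_iff_restrict hO.measurableSet).2 hf
  have hloc : ∀ {f : E3 → ℝ}, MemLp f 2 (volume.restrict O) →
      LocallyIntegrable (O.indicator f) volume := fun hf => (hmem hf).locallyIntegrable (by norm_num)
  set v : ℕ → E3 → ℝ := fun n => smoothing c hδ n (O.indicator u) with hv
  have hvs : ∀ n, ContDiff ℝ ∞ (v n) := fun n => contDiff_smoothing c hδ n (hloc hu2)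
  -- Differentiation commutes with the smoothing at every point of K, boundary included, up to the
  -- chain-rule factor t^|α|, which tends to 1.
  have hD : ∀ α ∈ multiIndices k, ∀ n, ∀ x ∈ K, multiD α (v n) x =
      shrink n ^ (∑ i, α i) * smoothing c hδ n (O.indicator (weakD O α u)) x := by
    intro α hα n x hx
    set φ := shrinkBump hδ n
    have ht1 := shrink_lt_one n
    have ht0 := shrink_ge n
    have hφ : ContDiff ℝ ∞ (φ.normed volume) := φ.contDiff_normed (n := ⊤)
    have hF : ContDiff ℝ ∞ (O.indicator u ⋆[ContinuousLinearMap.mul ℝ ℝ, volume] φ.normed volume) :=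
      φ.hasCompactSupport_normed.contDiff_convolution_right
        (ContinuousLinearMap.mul ℝ ℝ) (hloc hu2) (φ.contDiff_normed (n := ⊤))
    have e1 : v n = fun x => 1 * (O.indicator u ⋆[ContinuousLinearMap.mul ℝ ℝ, volume]
        φ.normed volume) (shrink n • x + (1 - shrink n) • c) := by
      funext x; rw [one_mul]; rfl
    rw [e1, multiD_const_mul_comp hF, one_mul,
      multiD_convolution (hloc hu2) φ.hasCompactSupport_normed hφ]
    beta_reduce
    rw [convolution_multiD_eq hO.measurableSet (weakD_spec hu hα).2 hφ φ.hasCompactSupport_normed]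
    · rfl
    intro w hw
    rw [φ.tsupport_normed_eq, mem_closedBall_zero_iff] at hw
    have hw' : ‖shrink n • x + (1 - shrink n) • c - w‖ ≤ (1 - shrink n) * δ := hw
    have hpos : 0 < 1 - shrink n := by linarith
    -- A point w within (1 - t)δ of tx + (1 - t)c is the combination tx + (1 - t)y with y in the
    -- ball of radius δ about c. Convexity then puts w in the interior of K, so the mollifier only
    -- uses values of u inside.
    have hy : c + (1 - shrink n)⁻¹ • (w - (shrink n • x + (1 - shrink n) • c)) ∈ O := by
      refine hball ?_
      rw [Metric.mem_closedBall, dist_eq_norm, add_sub_cancel_left, norm_smul, norm_sub_rev w,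
        norm_inv, Real.norm_of_nonneg hpos.le, inv_mul_le_iff₀ hpos]
      exact hw'
    have := hK.combo_self_interior_mem_interior hx hy (by linarith : 0 ≤ shrink n) hpos (by ring)
    convert this using 1
    rw [smul_add, smul_inv_smul₀ hpos.ne']
    module
  have hconv : ∀ α ∈ multiIndices k, Tendsto (fun n => eLpNorm (fun x => multiD α (v n) x -
      weakD O α u x) 2 (volume.restrict K)) atTop (𝓝 0) := by
    intro α hα
    set w := weakD O α u
    have hw := (weakD_spec hu hα).1
    have hwe : O.indicator w =ᵐ[volume.restrict K] w := by
      rw [← hres]; exact indicator_ae_eq_restrict hO.measurableSet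
    set a : ℕ → ℝ≥0∞ := fun n => eLpNorm (fun x => smoothing c hδ n (O.indicator w) x -
      O.indicator w x) 2 (volume.restrict K)
    have ha : Tendsto a atTop (𝓝 0) := tendsto_eLpNorm_smoothing_sub c hδ hKc (hmem hw)
    set N := eLpNorm w 2 (volume.restrict K)
    have hN : N ≠ ⊤ := by
      have := hw.2.ne
      rwa [hres] at this
    have hb : Tendsto (fun n => ‖shrink n ^ (∑ i, α i) - 1‖ₑ * N) atTop (𝓝 0) := by
      have h1 : Tendsto (fun n => shrink n ^ (∑ i, α i) - 1) atTop (𝓝 0) := by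
        simpa using (tendsto_shrink.pow (∑ i, α i)).sub_const 1
      have h2 : Tendsto (fun n => ‖shrink n ^ (∑ i, α i) - 1‖ₑ) atTop (𝓝 0) := by
        simpa using h1.enorm
      simpa using ENNReal.Tendsto.mul_const h2 (Or.inr hN)
    have hab := ha.add hb
    rw [add_zero] at hab
    refine tendsto_of_tendsto_of_tendsto_of_le_of_le tendsto_const_nhds hab (fun _ => zero_le)
      fun n => ?_
    set t := shrink n ^ (∑ i, α i)
    have ht : ‖t‖ₑ ≤ 1 := by
      have h0 : 0 ≤ shrink n := by linarith [shrink_ge n]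
      rw [Real.enorm_eq_ofReal (pow_nonneg h0 _), ENNReal.ofReal_le_one]
      exact pow_le_one₀ h0 (shrink_lt_one n).le
    have heq : (fun x => multiD α (v n) x - w x) =ᵐ[volume.restrict K]
        (t • (fun x => smoothing c hδ n (O.indicator w) x - O.indicator w x)) + (t - 1) • w := by
      filter_upwards [hwe, self_mem_ae_restrict hKm] with x hx hxK
      simp only [Pi.add_apply, Pi.smul_apply, smul_eq_mul, hD α hα n x hxK, hx]
      ring
    have hm1 : AEStronglyMeasurable (fun x => smoothing c hδ n (O.indicator w) x -
        O.indicator w x) (volume.restrict K) :=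
      ((contDiff_smoothing c hδ n (hloc hw)).continuous.aestronglyMeasurable).sub
        (hmem hw).1.restrict
    have hm2 : AEStronglyMeasurable w (volume.restrict K) := by rw [← hres]; exact hw.1
    rw [eLpNorm_congr_ae heq]
    refine (eLpNorm_add_le (hm1.const_smul t) (hm2.const_smul _) (by norm_num)).trans ?_
    rw [eLpNorm_const_smul, eLpNorm_const_smul]
    refine add_le_add ?_ le_rfl
    calc _ ≤ 1 * a n := by gcongr
      _ = a n := one_mul _
  obtain ⟨C, hC, hsob⟩ := exists_enorm_le_sum_eLpNorm hK hKc hK0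
  set b : ℕ → ℝ≥0∞ := fun n => ∑ α ∈ multiIndices 2, eLpNorm (fun x => multiD α (v n) x -
      weakD O α u x) 2 (volume.restrict K) with hb
  have hsub : multiIndices 2 ⊆ multiIndices k := fun α hα =>
    mem_multiIndices.2 ((mem_multiIndices.1 hα).trans hk)
  have hblim : Tendsto (fun n => C * b n) atTop (𝓝 0) := by
    have h1 : Tendsto b atTop (𝓝 (∑ α ∈ multiIndices 2, (0 : ℝ≥0∞))) :=
      tendsto_finsetSum _ fun α hα => hconv α (hsub hα)
    rw [Finset.sum_const_zero] at h1
    simpa using ENNReal.Tendsto.const_mul h1 (Or.inr hC)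
  -- The Sobolev inequality applied to v n - v m turns convergence of the derivatives in L² into
  -- uniform convergence on K. The limit is the continuous representative.
  have hcauchy_est : ∀ n m, ∀ x ∈ K, ‖v n x - v m x‖ₑ ≤ C * b n + C * b m := by
    intro n m x hx
    have h := hsob (fun x => v n x - v m x) ((hvs n).sub (hvs m)) x hx
    refine h.trans ?_
    rw [← mul_add, hb]
    simp only
    rw [← Finset.sum_add_distrib]
    refine mul_le_mul' le_rfl (Finset.sum_le_sum fun α hα => ?_)
    rw [multiD_sub (hvs n) (hvs m)]
    have hm2 : AEStronglyMeasurable (weakD O α u) (volume.restrict K) := by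
      rw [← hres]; exact (weakD_spec hu (hsub hα)).1.1
    have e : (fun x => multiD α (v n) x - multiD α (v m) x) =
        (fun x => multiD α (v n) x - weakD O α u x) - fun x => multiD α (v m) x - weakD O α u x := by
      funext x; simp
    rw [e]
    exact eLpNorm_sub_le ((contDiff_multiD (hvs n) α).continuous.aestronglyMeasurable.sub hm2)
      ((contDiff_multiD (hvs m) α).continuous.aestronglyMeasurable.sub hm2) (by norm_num)
  have huc : UniformCauchySeqOn v atTop K := by
    rw [Metric.uniformCauchySeqOn_iff]
    intro ε hε
    have hε2 : (0 : ℝ≥0∞) < ENNReal.ofReal (ε / 2) := ENNReal.ofReal_pos.2 (by positivity)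
    obtain ⟨N, hN⟩ := eventually_atTop.1 (hblim.eventually (gt_mem_nhds hε2))
    refine ⟨N, fun m hm n hn x hx => ?_⟩
    have h := (hcauchy_est m n x hx).trans_lt (ENNReal.add_lt_add (hN m hm) (hN n hn))
    rw [← ENNReal.ofReal_add (by positivity) (by positivity), add_halves,
      Real.enorm_eq_ofReal_abs, ENNReal.ofReal_lt_ofReal_iff hε] at h
    rwa [Real.dist_eq]
  have hlim : ∀ x, ∃ l, x ∈ K → Tendsto (fun n => v n x) atTop (𝓝 l) := by
    intro x
    by_cases hx : x ∈ K
    · obtain ⟨l, hl⟩ := cauchySeq_tendsto_of_complete (huc.cauchySeq hx)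
      exact ⟨l, fun _ => hl⟩
    · exact ⟨0, fun h => absurd h hx⟩
  choose g hg using hlim
  have hunif : TendstoUniformlyOn v g atTop K := huc.tendstoUniformlyOn_of_tendsto hg
  have hgc : ContinuousOn g K :=
    hunif.continuousOn (Eventually.of_forall fun n => (hvs n).continuous.continuousOn).frequently
  have h0 : (0 : Fin 3 → ℕ) ∈ multiIndices k := mem_multiIndices.2 (by simp)
  have hgu : g =ᵐ[volume.restrict K] u := by
    have hm2 : AEStronglyMeasurable (weakD O 0 u) (volume.restrict K) := by
      rw [← hres]; exact (weakD_spec hu h0).1.1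
    -- Convergence in L² gives a subsequence converging almost everywhere, which identifies the
    -- uniform limit with u.
    have h1 : TendstoInMeasure (volume.restrict K) v atTop (weakD O 0 u) :=
      tendstoInMeasure_of_tendsto_eLpNorm (p := 2) (by norm_num)
        (fun n => (hvs n).continuous.aestronglyMeasurable) hm2 (hconv 0 h0)
    obtain ⟨ns, hns, hae⟩ := h1.exists_seq_tendsto_ae
    have hwu : weakD O 0 u =ᵐ[volume.restrict K] u := by
      rw [← hres]; exact weakD_zero_ae_eq hO hu2
    filter_upwards [hae, hwu, self_mem_ae_restrict hKm] with x hx hxu hxK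
    rw [← hxu]
    exact tendsto_nhds_unique ((hg x hxK).comp hns.tendsto_atTop) hx
  refine ⟨contRep_spec hgc hgu, v, hvs, ?_, hconv⟩
  exact hunif.congr_right (contRep_eqOn hK ⟨c, hc⟩ hgc hgu).symm

end Approximation

/-! ### Polynomials as smooth functions. -/

section Polynomials

theorem contDiff_polyEval (f : Poly3) : ContDiff ℝ ∞ (polyEval f) := by
  induction f using MvPolynomial.induction_on with
  | C a =>
    have e : polyEval (MvPolynomial.C a) = fun _ => a := by funext x; simp [polyEval]
    rw [e]; exact contDiff_const
  | add p q hp hq =>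
    have e : polyEval (p + q) = fun x => polyEval p x + polyEval q x := by
      funext x; simp [polyEval]
    rw [e]; exact hp.add hq
  | mul_X p i hp =>
    have : ContDiff ℝ ∞ fun x : E3 => x i := by fun_prop
    have e : polyEval (p * MvPolynomial.X i) = fun x => polyEval p x * x i := by
      funext x; simp [polyEval]
    rw [e]; exact hp.mul this

theorem continuous_polyEval (f : Poly3) : Continuous (polyEval f) := (contDiff_polyEval f).continuous

theorem partialD_polyEval (f : Poly3) (i : Fin 3) :
    partialD i (polyEval f) = polyEval (MvPolynomial.pderiv i f) := by
  induction f using MvPolynomial.induction_on with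
  | C a =>
    have : polyEval (MvPolynomial.C a) = fun _ => a := by funext x; simp [polyEval]
    funext x
    simp [partialD, this, polyEval]
  | add p q hp hq =>
    have e : polyEval (p + q) = fun x => polyEval p x + polyEval q x := by
      funext x; simp [polyEval]
    funext x
    have h := (((contDiff_polyEval p).differentiable (by simp) x).hasFDerivAt.fun_add
      ((contDiff_polyEval q).differentiable (by simp) x).hasFDerivAt).fderiv
    have hp' := congrFun hp x
    have hq' := congrFun hq x
    simp only [partialD] at hp' hq' ⊢
    rw [e, h, add_apply, hp', hq']
    simp [polyEval]
  | mul_X p j hp =>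
    have e : polyEval (p * MvPolynomial.X j) = fun x => polyEval p x * x j := by
      funext x; simp [polyEval]
    funext x
    have hX : HasFDerivAt (fun x : E3 => x j) (EuclideanSpace.proj j : E3 →L[ℝ] ℝ) x :=
      (EuclideanSpace.proj j : E3 →L[ℝ] ℝ).hasFDerivAt
    have h := (((contDiff_polyEval p).differentiable (by simp) x).hasFDerivAt.fun_mul hX).fderiv
    have hp' := congrFun hp x
    simp only [partialD] at hp' ⊢
    rw [e, h]
    simp only [add_apply, smul_apply, hp']
    rw [MvPolynomial.pderiv_mul, MvPolynomial.pderiv_X]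
    by_cases hij : i = j
    · subst hij
      simp [polyEval]
      ring
    · simp [polyEval, Ne.symm hij]
      ring

end Polynomials

/-! ### Convexity, compactness and interior of the reference tetrahedron. -/

section ReferenceTetrahedron

theorem continuous_bary (j : Fin 4) : Continuous fun x : E3 => bary x j := by
  fin_cases j <;> simp [bary] <;> fun_prop

theorem bary_combo (x y : E3) {a b : ℝ} (hab : a + b = 1) (j : Fin 4) :
    bary (a • x + b • y) j = a * bary x j + b * bary y j := by
  have hb : b = 1 - a := by linarith
  subst hb
  fin_cases j <;> simp [bary]
  ring

theorem convex_refTet : Convex ℝ refTet := by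
  intro x hx y hy a b ha hb hab j
  rw [bary_combo x y hab]
  have := hx j
  have := hy j
  positivity

theorem isClosed_refTet : IsClosed refTet := by
  have : refTet = ⋂ j, {x | 0 ≤ bary x j} := by ext x; simp [refTet]
  rw [this]
  exact isClosed_iInter fun j => isClosed_le continuous_const (continuous_bary j)

theorem coord_mem_of_mem_refTet {x : E3} (hx : x ∈ refTet) (i : Fin 3) : 0 ≤ x i ∧ x i ≤ 1 := by
  have h0 := hx 0
  have h1 := hx 1
  have h2 := hx 2
  have h3 := hx 3
  simp [bary] at h0 h1 h2 h3
  fin_cases i <;> simp <;> constructor <;> linarith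

theorem isCompact_refTet : IsCompact refTet := by
  refine Metric.isCompact_of_isClosed_isBounded isClosed_refTet ?_
  refine (Metric.isBounded_closedBall (x := (0 : E3)) (r := 2)).subset fun x hx => ?_
  rw [mem_closedBall_zero_iff, EuclideanSpace.norm_eq]
  refine Real.sqrt_le_iff.2 ⟨by norm_num, ?_⟩
  have h := fun i => coord_mem_of_mem_refTet hx i
  have h' : ∀ i, ‖x i‖ ^ 2 ≤ 1 := fun i => by
    rw [Real.norm_eq_abs, sq_abs]
    nlinarith [(h i).1, (h i).2]
  rw [Fin.sum_univ_three]
  linarith [h' 0, h' 1, h' 2]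

theorem mem_interior_refTet {x : E3} (hx : ∀ i, x i ∈ Set.Ioo (0 : ℝ) (1 / 3)) :
    x ∈ interior refTet := by
  refine mem_interior.2 ⟨{x | ∀ j, 0 < bary x j}, fun y hy j => (hy j).le, ?_, ?_⟩
  · have : {x | ∀ j, 0 < bary x j} = ⋂ j, {x | 0 < bary x j} := by ext x; simp
    rw [this]
    exact isOpen_iInter_of_finite fun j => isOpen_lt continuous_const (continuous_bary j)
  · intro j
    have h0 := hx 0
    have h1 := hx 1
    have h2 := hx 2
    simp only [Set.mem_Ioo] at h0 h1 h2
    fin_cases j <;> simp [bary] <;> linarith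

theorem interior_refTet_nonempty : (interior refTet).Nonempty :=
  ⟨WithLp.toLp 2 fun _ => 1 / 4, mem_interior_refTet fun i => by norm_num⟩

theorem measurableSet_refTet : MeasurableSet refTet := isClosed_refTet.measurableSet

theorem volume_refTet_ne_top : volume refTet ≠ ⊤ := isCompact_refTet.measure_ne_top

theorem volume_real_refTet_pos : 0 < volume.real refTet := by
  refine ENNReal.toReal_pos ?_ volume_refTet_ne_top
  exact (lt_of_lt_of_le (isOpen_interior.measure_pos volume interior_refTet_nonempty)
    (measure_mono interior_subset)).ne'

/-- The tetrahedron contains the cube (0, 1/3)³, a product of infinite sets, and a polynomial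
vanishing on such a product is zero. -/
theorem eq_zero_of_polyEval_ae_eq_zero {f : Poly3}
    (hf : polyEval f =ᵐ[volume.restrict refTet] 0) : f = 0 := by
  have h := eqOn_of_ae_eq_restrict convex_refTet interior_refTet_nonempty
    (continuous_polyEval f).continuousOn continuousOn_const hf
  refine MvPolynomial.funext_set (fun _ => Set.Ioo (0 : ℝ) (1 / 3))
    (fun _ => Set.Ioo_infinite (by norm_num)) fun x hx => ?_
  have := h (interior_subset (mem_interior_refTet (x := WithLp.toLp 2 x) fun i =>
    hx i (Set.mem_univ i)))
  rw [map_zero]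
  exact this

end ReferenceTetrahedron

/-! ### Norm equivalences on finite-dimensional polynomial spaces. -/

section FiniteDimension

/-- A factors through the range of G, and a linear map on a finite-dimensional space is bounded.
This yields both the inverse estimate and the Poincaré-type estimate below. -/
theorem exists_norm_le_of_ker_le {V F H : Type*} [AddCommGroup V] [Module ℝ V]
    [FiniteDimensional ℝ V] [NormedAddCommGroup F] [NormedSpace ℝ F] [NormedAddCommGroup H]
    [NormedSpace ℝ H] (A : V →ₗ[ℝ] F) (G : V →ₗ[ℝ] H)
    (h : LinearMap.ker G ≤ LinearMap.ker A) : ∃ C : ℝ, 0 ≤ C ∧ ∀ v, ‖A v‖ ≤ C * ‖G v‖ := by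
  let B : LinearMap.range G →ₗ[ℝ] F :=
    ((LinearMap.ker G).liftQ A h) ∘ₗ (G.quotKerEquivRange.symm : _ →ₗ[ℝ] _)
  have hB : ∀ v, B ⟨G v, LinearMap.mem_range_self G v⟩ = A v := by
    intro v
    have : G.quotKerEquivRange.symm ⟨G v, LinearMap.mem_range_self G v⟩ =
        (LinearMap.ker G).mkQ v := by
      rw [LinearEquiv.symm_apply_eq]; rfl
    simp only [B, LinearMap.comp_apply, LinearEquiv.coe_coe, this]
    simp
  obtain ⟨C, hC, hle⟩ := (LinearMap.toContinuousLinearMap B).bound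
  refine ⟨C, hC.le, fun v => ?_⟩
  rw [← hB v]
  exact hle ⟨G v, LinearMap.mem_range_self G v⟩

theorem eLpNorm_two_eq_ofReal_sqrt {μ : Measure E3} {f : E3 → ℝ} (hf : MemLp f 2 μ) :
    eLpNorm f 2 μ = ENNReal.ofReal (Real.sqrt (∫ x, f x ^ 2 ∂μ)) := by
  rw [hf.eLpNorm_eq_integral_rpow_norm two_ne_zero ENNReal.ofNat_ne_top]
  simp [Real.sqrt_eq_rpow]

theorem memLp_of_continuousOn {K : Set E3} (hK : IsCompact K) {f : E3 → ℝ}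
    (hf : ContinuousOn f K) : MemLp f 2 (volume.restrict K) := by
  obtain ⟨C, hC⟩ := hK.exists_bound_of_continuousOn hf
  have : IsFiniteMeasure (volume.restrict K : Measure E3) :=
    ⟨by rw [Measure.restrict_apply_univ]; exact hK.measure_lt_top⟩
  refine MemLp.of_bound (hf.aestronglyMeasurable hK.measurableSet) C ?_
  filter_upwards [self_mem_ae_restrict hK.measurableSet] with x hx using hC x hx

theorem memLp_polyEval (f : Poly3) : MemLp (polyEval f) 2 (volume.restrict refTet) :=
  memLp_of_continuousOn isCompact_refTet (continuous_polyEval f).continuousOn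

/-- A polynomial as an element of `L²` of the reference tetrahedron. -/
def polyToLp : Poly3 →ₗ[ℝ] Lp ℝ 2 (volume.restrict refTet) where
  toFun f := (memLp_polyEval f).toLp _
  map_add' f g := by
    rw [← MemLp.toLp_add]
    congr 1
    funext x
    simp [polyEval]
  map_smul' c f := by
    rw [RingHom.id_apply, ← MemLp.toLp_const_smul]
    congr 1
    funext x
    simp [polyEval]

theorem norm_polyToLp (f : Poly3) :
    ‖polyToLp f‖ = Real.sqrt (∫ x in refTet, polyEval f x ^ 2) := by
  change ‖(memLp_polyEval f).toLp _‖ = _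
  rw [Lp.norm_toLp, eLpNorm_two_eq_ofReal_sqrt (memLp_polyEval f),
    ENNReal.toReal_ofReal (Real.sqrt_nonneg _)]

theorem polyToLp_eq_zero {f : Poly3} (h : polyToLp f = 0) : f = 0 := by
  refine eq_zero_of_polyEval_ae_eq_zero ?_
  exact (MemLp.toLp_eq_toLp_iff (memLp_polyEval f) (MemLp.zero (ε := ℝ))).1 (by simpa using! h)

/-- A polynomial as a continuous function on the reference tetrahedron. -/
def polyToCont : Poly3 →ₗ[ℝ] C(refTet, ℝ) where
  toFun f := ⟨fun x => polyEval f x, (continuous_polyEval f).comp continuous_subtype_val⟩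
  map_add' f g := by ext x; simp [polyEval]
  map_smul' c f := by ext x; simp [polyEval]

instance : CompactSpace refTet := isCompact_iff_compactSpace.1 isCompact_refTet

theorem exists_abs_polyEval_le (D : Submodule ℝ Poly3) [FiniteDimensional ℝ D] :
    ∃ C : ℝ, 0 ≤ C ∧ ∀ f ∈ D, ∀ x ∈ refTet,
      |polyEval f x| ≤ C * Real.sqrt (∫ x in refTet, polyEval f x ^ 2) := by
  obtain ⟨C, hC, h⟩ := exists_norm_le_of_ker_le (polyToCont ∘ₗ D.subtype) (polyToLp ∘ₗ D.subtype)
    (fun f hf => by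
      have : (f : Poly3) = 0 := polyToLp_eq_zero hf
      simp [this])
  refine ⟨C, hC, fun f hf x hx => ?_⟩
  have h1 := h ⟨f, hf⟩
  rw [LinearMap.comp_apply, LinearMap.comp_apply, Submodule.subtype_apply, norm_polyToLp] at h1
  exact ((polyToCont f).norm_coe_le_norm ⟨x, hx⟩).trans h1

/-- A polynomial with vanishing gradient is constant, so f ↦ f - f(0) vanishes on the kernel of the
gradient. -/
theorem exists_abs_polyEval_sub_le (D : Submodule ℝ Poly3) [FiniteDimensional ℝ D] :
    ∃ C : ℝ, 0 ≤ C ∧ ∀ f ∈ D, ∀ x ∈ refTet, |polyEval f x - polyEval f 0| ≤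
      C * Real.sqrt (∑ i, ∫ x in refTet, polyEval (MvPolynomial.pderiv i f) x ^ 2) := by
  let evalZero : Poly3 →ₗ[ℝ] Poly3 :=
    { toFun := fun f => f - MvPolynomial.C (polyEval f 0)
      map_add' := fun f g => by simp [polyEval]; ring
      map_smul' := fun c f => by
        simp [polyEval, MvPolynomial.smul_eq_C_mul]; ring }
  let G : D →ₗ[ℝ] (Fin 3 → Lp ℝ 2 (volume.restrict refTet)) :=
    LinearMap.pi fun i => polyToLp ∘ₗ
      ((MvPolynomial.pderiv i : Derivation ℝ Poly3 Poly3) : Poly3 →ₗ[ℝ] Poly3) ∘ₗ D.subtype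
  have hG : ∀ f i, G f i = polyToLp (MvPolynomial.pderiv i (f : Poly3)) := fun f i => rfl
  obtain ⟨C, hC, h⟩ := exists_norm_le_of_ker_le (polyToCont ∘ₗ evalZero ∘ₗ D.subtype) G
    (fun f hf => by
      have hp : ∀ i, MvPolynomial.pderiv i (f : Poly3) = 0 := fun i =>
        polyToLp_eq_zero ((hG f i).symm.trans (congrFun (LinearMap.mem_ker.1 hf) i))
      have hfd : ∀ x, fderiv ℝ (polyEval (f : Poly3)) x = 0 := by
        intro x
        ext z
        rw [fderiv_eq_sum_partialD]
        simp [partialD_polyEval, hp, polyEval]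
      have hconst := is_const_of_fderiv_eq_zero
        ((contDiff_polyEval (f : Poly3)).differentiable (by simp)) hfd
      rw [LinearMap.mem_ker]
      ext x
      have := hconst x 0
      simp only [polyEval] at this
      simp [evalZero, polyToCont, polyEval, this])
  refine ⟨C, hC, fun f hf x hx => ?_⟩
  have h1 := h ⟨f, hf⟩
  have h2 : ‖G ⟨f, hf⟩‖ ≤
      Real.sqrt (∑ i, ∫ x in refTet, polyEval (MvPolynomial.pderiv i f) x ^ 2) := by
    refine (pi_norm_le_iff_of_nonneg (Real.sqrt_nonneg _)).2 fun i => ?_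
    rw [hG, norm_polyToLp]
    refine Real.sqrt_le_sqrt ?_
    exact Finset.single_le_sum
      (f := fun i => ∫ x in refTet, polyEval (MvPolynomial.pderiv i f) x ^ 2)
      (fun _ _ => integral_nonneg fun _ => sq_nonneg _) (Finset.mem_univ i)
  have h3 := (polyToCont (evalZero f)).norm_coe_le_norm ⟨x, hx⟩
  have h4 : polyToCont (evalZero f) ⟨x, hx⟩ = polyEval f x - polyEval f 0 := by
    simp [polyToCont, evalZero, polyEval]
  rw [h4] at h3
  exact h3.trans (h1.trans (by gcongr))

theorem finiteDimensional_of_unisolvent {R : RefElement} (h : R.Unisolvent) :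
    FiniteDimensional ℝ R.space := by
  let ev : R.space →ₗ[ℝ] (R.nodes → ℝ) :=
    { toFun := fun u x => polyEval (u : Poly3) (x : E3)
      map_add' := fun u v => by funext x; simp [polyEval]
      map_smul' := fun c u => by funext x; simp [polyEval] }
  exact FiniteDimensional.of_injective ev h.1

theorem finiteDimensional_derivSpace (U : Submodule ℝ Poly3) [FiniteDimensional ℝ U] :
    FiniteDimensional ℝ (derivSpace U) := by
  have hle : derivSpace U ≤ ⨆ i : Fin 3, U.map
      ((MvPolynomial.pderiv i : Derivation ℝ Poly3 Poly3) : Poly3 →ₗ[ℝ] Poly3) := by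
    refine Submodule.span_le.2 ?_
    rintro f ⟨i, u, hu, rfl⟩
    exact Submodule.mem_iSup_of_mem i ⟨u, hu, rfl⟩
  exact Submodule.finiteDimensional_of_le hle

theorem one_mem_derivSpace {U : Submodule ℝ Poly3} (h : polySpace 2 ≤ U) : 1 ∈ derivSpace U := by
  refine Submodule.subset_span ⟨0, MvPolynomial.X 0, h ?_, by simp⟩
  rw [MvPolynomial.mem_restrictTotalDegree, MvPolynomial.totalDegree_X]
  norm_num

/-- X_i = ½ ∂_i X_i², and X_i² is available because U contains the quadratics. These elements raise
the exactness against constants by one degree. -/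
theorem X_mem_derivSpace {U : Submodule ℝ Poly3} (h : polySpace 2 ≤ U) (i : Fin 3) :
    MvPolynomial.X i ∈ derivSpace U := by
  have h2 : (MvPolynomial.X i ^ 2 : Poly3) ∈ U := by
    refine h ?_
    rw [MvPolynomial.mem_restrictTotalDegree]
    refine (MvPolynomial.totalDegree_pow _ _).trans ?_
    simp
  have h3 : (MvPolynomial.X i : Poly3) = (1 / 2 : ℝ) • MvPolynomial.pderiv i (MvPolynomial.X i ^ 2) := by
    rw [MvPolynomial.pderiv_pow, MvPolynomial.pderiv_X_self, MvPolynomial.smul_eq_C_mul]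
    have : (2 : Poly3) = MvPolynomial.C 2 := (map_ofNat MvPolynomial.C 2).symm
    simp only [Nat.cast_ofNat, mul_one, Nat.add_one_sub_one, pow_one]
    rw [this, ← mul_assoc, ← MvPolynomial.C_mul]
    norm_num
  rw [h3]
  exact Submodule.smul_mem _ _ (Submodule.subset_span ⟨i, _, h2, rfl⟩)

end FiniteDimension

/-! ### Geometry of a physical element and change of variables. -/

section Cell

variable (e : Affine.Simplex ℝ E3 3)

/-- The coordinates of the element map as polynomials of degree one. -/
def elemPoly (i : Fin 3) : Poly3 :=
  MvPolynomial.X 0 * MvPolynomial.C (e.points 0 i) + MvPolynomial.X 1 * MvPolynomial.C (e.points 1 i) +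
    MvPolynomial.X 2 * MvPolynomial.C (e.points 2 i) +
    (1 - MvPolynomial.X 0 - MvPolynomial.X 1 - MvPolynomial.X 2) * MvPolynomial.C (e.points 3 i)

theorem elemMap_apply (x : E3) (i : Fin 3) : elemMap e x i = polyEval (elemPoly e i) x := by
  simp [elemMap, elemPoly, polyEval, Fin.sum_univ_four, bary]

theorem totalDegree_elemPoly_le (i : Fin 3) : (elemPoly e i).totalDegree ≤ 1 := by
  have hX : ∀ j : Fin 3, (MvPolynomial.X j : Poly3) ∈ polySpace 1 := fun j => by
    rw [MvPolynomial.mem_restrictTotalDegree, MvPolynomial.totalDegree_X]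
  have h1 : (1 : Poly3) ∈ polySpace 1 := by
    rw [MvPolynomial.mem_restrictTotalDegree, MvPolynomial.totalDegree_one]; norm_num
  have hC : ∀ (f : Poly3) (a : ℝ), f ∈ polySpace 1 → f * MvPolynomial.C a ∈ polySpace 1 := by
    intro f a hf
    rw [mul_comm, ← MvPolynomial.smul_eq_C_mul]
    exact Submodule.smul_mem _ _ hf
  rw [← MvPolynomial.mem_restrictTotalDegree]
  exact Submodule.add_mem _ (Submodule.add_mem _ (Submodule.add_mem _ (hC _ _ (hX 0))
    (hC _ _ (hX 1))) (hC _ _ (hX 2)))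
    (hC _ _ (Submodule.sub_mem _ (Submodule.sub_mem _ (Submodule.sub_mem _ h1 (hX 0)) (hX 1)) (hX 2)))

/-- The linear part of the element map. -/
def elemLin : E3 →ₗ[ℝ] E3 where
  toFun z := ∑ i : Fin 3, z i • (e.points i.castSucc - e.points 3)
  map_add' x y := by simp [add_smul, Finset.sum_add_distrib]
  map_smul' c x := by simp [mul_smul, Finset.smul_sum]

theorem elemMap_eq_elemLin (x : E3) : elemMap e x = elemLin e x + e.points 3 := by
  simp only [elemMap, elemLin, LinearMap.coe_mk, AddHom.coe_mk, Fin.sum_univ_four,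
    Fin.sum_univ_three, bary]
  simp only [Matrix.cons_val]
  simp
  module

theorem elemLin_injective : Function.Injective (elemLin e) := by
  rw [injective_iff_map_eq_zero]
  intro z hz
  -- A kernel vector z gives weights z₀, z₁, z₂, -(z₀ + z₁ + z₂) of sum zero on the vertices, and
  -- these vanish by affine independence.
  have hind := affineIndependent_iff.1 e.independent Finset.univ
    ![z 0, z 1, z 2, -z 0 - z 1 - z 2] (by simp [Fin.sum_univ_four]) ?_
  · ext i
    fin_cases i
    · exact hind 0 (Finset.mem_univ _)
    · exact hind 1 (Finset.mem_univ _)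
    · exact hind 2 (Finset.mem_univ _)
  · refine (Fin.sum_univ_four _).trans (Eq.trans ?_ hz)
    simp only [elemLin, LinearMap.coe_mk, AddHom.coe_mk, Fin.sum_univ_three]
    simp only [Matrix.cons_val]
    simp
    module

/-- The linear part of the element map as an isomorphism. -/
def elemEquiv : E3 ≃L[ℝ] E3 :=
  (LinearEquiv.ofInjectiveEndo (elemLin e) (elemLin_injective e)).toContinuousLinearEquiv

theorem elemMap_eq (x : E3) : elemMap e x = elemEquiv e x + e.points 3 := elemMap_eq_elemLin e x

/-- The inverse of the element map. -/
def elemInv (y : E3) : E3 := (elemEquiv e).symm (y - e.points 3)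

@[simp] theorem elemInv_elemMap (x : E3) : elemInv e (elemMap e x) = x := by
  simp [elemInv, elemMap_eq]

@[simp] theorem elemMap_elemInv (y : E3) : elemMap e (elemInv e y) = y := by
  simp [elemInv, elemMap_eq]

theorem contDiff_elemInv : ContDiff ℝ ∞ (elemInv e) :=
  (elemEquiv e).symm.contDiff.comp (contDiff_id.sub contDiff_const)

theorem hasFDerivAt_elemMap (x : E3) :
    HasFDerivAt (elemMap e) (elemEquiv e : E3 →L[ℝ] E3) x := by
  have h : elemMap e = fun x => elemEquiv e x + e.points 3 := funext (elemMap_eq e)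
  rw [h]
  exact (elemEquiv e).hasFDerivAt.add_const _

theorem continuous_elemMap : Continuous (elemMap e) :=
  continuous_iff_continuousAt.2 fun x => (hasFDerivAt_elemMap e x).continuousAt

theorem elemMap_injective : Function.Injective (elemMap e) :=
  Function.LeftInverse.injective (elemInv_elemMap e)

theorem elemMap_mem_cell {x : E3} (hx : x ∈ refTet) : elemMap e x ∈ cell e := ⟨x, hx, rfl⟩

theorem isCompact_cell : IsCompact (cell e) := isCompact_refTet.image (continuous_elemMap e)

theorem measurableSet_cell : MeasurableSet (cell e) := (isCompact_cell e).measurableSet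

theorem convex_cell : Convex ℝ (cell e) := by
  rintro _ ⟨x, hx, rfl⟩ _ ⟨y, hy, rfl⟩ a b ha hb hab
  refine ⟨a • x + b • y, convex_refTet hx hy ha hb hab, ?_⟩
  simp only [elemMap_eq, map_add, map_smul]
  have hb' : b = 1 - a := by linarith
  subst hb'
  module

theorem interior_cell_nonempty : (interior (cell e)).Nonempty := by
  obtain ⟨x, hx⟩ := interior_refTet_nonempty
  have h : elemMap e '' interior refTet = elemInv e ⁻¹' interior refTet := by
    ext y
    constructor
    · rintro ⟨z, hz, rfl⟩
      simpa using hz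
    · intro hy
      exact ⟨_, hy, elemMap_elemInv e y⟩
  refine ⟨elemMap e x, mem_interior.2 ⟨elemMap e '' interior refTet,
    Set.image_mono interior_subset, ?_, ⟨x, hx, rfl⟩⟩⟩
  rw [h]
  exact isOpen_interior.preimage (contDiff_elemInv e).continuous

theorem setIntegral_cell_eq_det (F : E3 → ℝ) :
    ∫ y in cell e, F y = |(elemEquiv e : E3 →L[ℝ] E3).det| * ∫ x in refTet, F (elemMap e x) := by
  rw [cell, integral_image_eq_integral_abs_det_fderiv_smul volume measurableSet_refTet
    (fun x _ => (hasFDerivAt_elemMap e x).hasFDerivWithinAt) (elemMap_injective e).injOn]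
  simp only [smul_eq_mul]
  rw [integral_const_mul]

/-- The ratio `|e| / |ẽ|`. -/
def volRatio : ℝ := volume.real (cell e) / volume.real refTet

/-- Integrating the constant 1 identifies |det| with |e|/|ẽ|, the factor used in the quadrature sum.
-/
theorem setIntegral_cell (F : E3 → ℝ) :
    ∫ y in cell e, F y = volRatio e * ∫ x in refTet, F (elemMap e x) := by
  have h1 := setIntegral_cell_eq_det e fun _ => 1
  simp only [integral_const, smul_eq_mul, mul_one, measureReal_restrict_apply_univ] at h1
  rw [setIntegral_cell_eq_det, volRatio, h1, mul_div_cancel_right₀ _ volume_real_refTet_pos.ne']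

theorem volume_real_cell_pos : 0 < volume.real (cell e) := by
  refine ENNReal.toReal_pos ?_ (isCompact_cell e).measure_ne_top
  exact (lt_of_lt_of_le (isOpen_interior.measure_pos volume (interior_cell_nonempty e))
    (measure_mono interior_subset)).ne'

theorem volRatio_pos : 0 < volRatio e := div_pos (volume_real_cell_pos e) volume_real_refTet_pos

theorem ae_cell_of_ae_refTet {P : E3 → Prop}
    (h : ∀ᵐ x ∂volume.restrict refTet, P (elemMap e x)) : ∀ᵐ y ∂volume.restrict (cell e), P y := by
  rw [ae_restrict_iff' (measurableSet_cell e)]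
  rw [ae_restrict_iff' measurableSet_refTet] at h
  have hnull : volume (elemMap e '' {x | ¬(x ∈ refTet → P (elemMap e x))}) = 0 :=
    addHaar_image_eq_zero_of_differentiableOn_of_addHaar_eq_zero volume
      (fun x _ => (hasFDerivAt_elemMap e x).differentiableAt.differentiableWithinAt) h
  refine measure_mono_null ?_ hnull
  intro y hy
  simp only [Set.mem_compl_iff, Set.mem_ofPred_eq, Classical.not_imp] at hy
  obtain ⟨⟨x, hx, rfl⟩, hP⟩ := hy
  exact ⟨x, by simp [hx, hP], rfl⟩

end Cell

/-! ### Mesh size and decomposition of the domain. -/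

section MeshGeometry

variable {Ω : Set E3} (T : TetMesh Ω)

/-- A ball of radius r has diameter 2r. The set of admissible radii is nonempty because there are
finitely many compact cells, so the bound passes to its infimum. -/
theorem norm_sub_le_of_mem_cell {e : Affine.Simplex ℝ E3 3} (he : e ∈ T.elems) {x y : E3}
    (hx : x ∈ cell e) (hy : y ∈ cell e) : ‖x - y‖ ≤ 2 * T.size := by
  have hne : {r : ℝ | 0 ≤ r ∧ ∀ e ∈ T.elems, ∃ c : E3, cell e ⊆ Metric.closedBall c r}.Nonempty := by
    have hb : Bornology.IsBounded (⋃ e ∈ T.elems, cell e) :=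
      (Bornology.isBounded_biUnion_finset T.elems).2 fun e _ => (isCompact_cell e).isBounded
    obtain ⟨r, hr⟩ := hb.subset_closedBall 0
    refine ⟨|r|, abs_nonneg r, fun e he => ⟨0, ?_⟩⟩
    exact (Set.subset_biUnion_of_mem (u := fun e => cell e) he).trans
      (hr.trans (Metric.closedBall_subset_closedBall (le_abs_self r)))
  have h : ‖x - y‖ / 2 ≤ T.size := by
    refine le_csInf hne ?_
    rintro r ⟨-, hr⟩
    obtain ⟨c, hc⟩ := hr e he
    have h1 := Metric.mem_closedBall.1 (hc hx)
    have h2 := Metric.mem_closedBall.1 (hc hy)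
    rw [← dist_eq_norm]
    linarith [dist_triangle_right x y c]
  linarith

theorem size_nonneg : 0 ≤ T.size := Real.sInf_nonneg fun _ hr => hr.1

/-- The interiors lie in Ω, and what they miss lies on frontiers of convex cells, which are null.
Nothing about the boundary of Ω is needed. -/
theorem ae_eq_iUnion_interior :
    Ω =ᵐ[volume] ⋃ e ∈ T.elems, interior (cell e) := by
  refine Filter.EventuallyLE.antisymm ?_ ?_
  · have hnull : volume (⋃ e ∈ T.elems, frontier (cell e)) = 0 :=
      (measure_biUnion_null_iff T.elems.countable_toSet).2 fun e _ =>
        (convex_cell e).addHaar_frontier volume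
    refine (ae_le_set.2 (measure_mono_null ?_ hnull))
    rintro x ⟨hx, hx'⟩
    have : x ∈ ⋃ e ∈ T.elems, cell e := by rw [T.cover]; exact subset_closure hx
    simp only [Set.mem_iUnion, not_exists] at this hx' ⊢
    obtain ⟨e, he, hxe⟩ := this
    exact ⟨e, he, subset_closure hxe, hx' e he⟩
  · exact (Set.iUnion₂_subset T.interior_subset).eventuallyLE

theorem setIntegral_mesh {F : E3 → ℝ} (hF : IntegrableOn F Ω) :
    ∫ x in Ω, F x = ∑ e ∈ T.elems, ∫ x in cell e, F x := by
  rw [setIntegral_congr_set (ae_eq_iUnion_interior T),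
    integral_biUnion_finset T.elems (fun e _ => isOpen_interior.measurableSet)
      (fun e he e' he' hne => T.disjoint_interior e he e' he' hne)
      (fun e he => hF.mono_set (T.interior_subset e he))]
  exact Finset.sum_congr rfl fun e _ => by rw [restrict_interior_eq (convex_cell e)]

end MeshGeometry

/-! ### Quadrature error on the reference element for smooth and Sobolev functions. -/

section ReferenceError

variable (S : QuadRule)

/-- The quadrature error on the reference tetrahedron. -/
def refErr (F : E3 → ℝ) : ℝ := (∫ x in refTet, F x) - ∑ x ∈ S.nodes, S.weight x * F x

theorem integrableOn_refTet {F : E3 → ℝ} (hF : ContinuousOn F refTet) : IntegrableOn F refTet :=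
  hF.integrableOn_compact isCompact_refTet

theorem refErr_sub {F G : E3 → ℝ} (hF : ContinuousOn F refTet) (hG : ContinuousOn G refTet) :
    refErr S (fun x => F x - G x) = refErr S F - refErr S G := by
  unfold refErr
  rw [integral_sub (integrableOn_refTet hF) (integrableOn_refTet hG)]
  simp only [mul_sub, Finset.sum_sub_distrib]
  ring

theorem refErr_const_mul (c : ℝ) (F : E3 → ℝ) : refErr S (fun x => c * F x) = c * refErr S F := by
  unfold refErr
  rw [integral_const_mul, mul_sub, Finset.mul_sum]
  congr 1
  exact Finset.sum_congr rfl fun x _ => by ring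

theorem refErr_sum {ι : Type*} (s : Finset ι) (F : ι → E3 → ℝ)
    (hF : ∀ i ∈ s, ContinuousOn (F i) refTet) :
    refErr S (fun x => ∑ i ∈ s, F i x) = ∑ i ∈ s, refErr S (F i) := by
  unfold refErr
  rw [integral_finsetSum _ fun i hi => integrableOn_refTet (hF i hi), Finset.sum_sub_distrib]
  simp only [Finset.mul_sum]
  rw [Finset.sum_comm]

theorem enorm_refErr_mul_le (F g : E3 → ℝ) {M : ℝ} (hM : ∀ x ∈ refTet, |g x| ≤ M) :
    ‖refErr S (fun x => F x * g x)‖ₑ ≤ ENNReal.ofReal M *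
      ((∫⁻ x in refTet, ‖F x‖ₑ) + ∑ x ∈ S.nodes, ‖S.weight x‖ₑ * ‖F x‖ₑ) := by
  have hg : ∀ x ∈ refTet, ‖g x‖ₑ ≤ ENNReal.ofReal M := fun x hx => by
    rw [Real.enorm_eq_ofReal_abs]
    exact ENNReal.ofReal_le_ofReal (hM x hx)
  refine (enorm_sub_le).trans ?_
  rw [mul_add]
  refine add_le_add ?_ ?_
  · refine (enorm_integral_le_lintegral_enorm _).trans ?_
    rw [← lintegral_const_mul' _ _ ENNReal.ofReal_ne_top]
    refine setLIntegral_mono' measurableSet_refTet fun x hx => ?_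
    rw [enorm_mul, mul_comm]
    gcongr
    exact hg x hx
  · refine (enorm_sum_le _ _).trans ?_
    rw [Finset.mul_sum]
    refine Finset.sum_le_sum fun x hx => ?_
    rw [enorm_mul, enorm_mul]
    calc ‖S.weight x‖ₑ * (‖F x‖ₑ * ‖g x‖ₑ)
        ≤ ‖S.weight x‖ₑ * (‖F x‖ₑ * ENNReal.ofReal M) := by
          gcongr
          exact hg x (S.nodes_mem x hx)
      _ = _ := by ring

/-- The total mass of the integral and of the quadrature rule. -/
def quadMass : ℝ := volume.real refTet + ∑ x ∈ S.nodes, |S.weight x|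

theorem quadMass_pos : 0 < quadMass S :=
  add_pos_of_pos_of_nonneg volume_real_refTet_pos (Finset.sum_nonneg fun _ _ => abs_nonneg _)

theorem ofReal_quadMass :
    ENNReal.ofReal (quadMass S) = volume refTet + ∑ x ∈ S.nodes, ‖S.weight x‖ₑ := by
  rw [quadMass, ENNReal.ofReal_add measureReal_nonneg (Finset.sum_nonneg fun _ _ => abs_nonneg _),
    ofReal_measureReal volume_refTet_ne_top, ENNReal.ofReal_sum_of_nonneg fun _ _ => abs_nonneg _]
  simp only [Real.enorm_eq_ofReal_abs]

/-- The error of a rule that is exact for polynomials of degree `m` against `g`, for smooth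
functions on a physical element. -/
theorem enorm_refErr_smooth_le (e : Affine.Simplex ℝ E3 3) {m : ℕ} (hm : 1 ≤ m) {g : Poly3}
    (hex : ∀ f ∈ polySpace m, refErr S (fun x => polyEval f x * polyEval g x) = 0) {M : ℝ}
    (hM : ∀ x ∈ refTet, |polyEval g x| ≤ M) {d : ℝ}
    (hd : ∀ x ∈ cell e, ∀ y ∈ cell e, ‖x - y‖ ≤ d) {v : E3 → ℝ} (hv : ContDiff ℝ ∞ v) :
    volume (cell e) * ‖refErr S (fun x => v (elemMap e x) * polyEval g x)‖ₑ ≤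
      ENNReal.ofReal M * ENNReal.ofReal (quadMass S) *
        (ENNReal.ofReal ((3 * d) ^ (m + 1)) * 2 * (volume (cell e)) ^ (1 / 2 : ℝ) *
          ∑ α ∈ topIndices (m + 1), eLpNorm (multiD α v) 2 (volume.restrict (cell e))) := by
  set K := cell e
  set B := ENNReal.ofReal ((3 * d) ^ (m + 1)) * 2 * (volume K) ^ (1 / 2 : ℝ) *
    ∑ α ∈ topIndices (m + 1), eLpNorm (multiD α v) 2 (volume.restrict K)
  set H : E3 → E3 → ℝ := fun y x => v (elemMap e x) - taylorAt (m + 1) v y (elemMap e x) with hH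
  have hHc : Continuous fun q : E3 × E3 => H q.1 q.2 := by
    have h1 : Continuous fun q : E3 × E3 => elemMap e q.2 :=
      (continuous_elemMap e).comp continuous_snd
    exact (hv.continuous.comp h1).sub
      ((continuous_taylorAt (m + 1) hv).comp (continuous_fst.prodMk h1))
  have hB : ∀ x ∈ refTet, ∫⁻ y in K, ‖H y x‖ₑ ≤ B := fun x hx =>
    lintegral_sub_taylorAt_le (convex_cell e) (measurableSet_cell e) (elemMap_mem_cell e hx) hm
      (hd _ (elemMap_mem_cell e hx)) hv
  -- For every centre y the pulled-back Taylor polynomial has zero error against g, so only the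
  -- remainder H y contributes.
  have hy : ∀ y, ‖refErr S (fun x => v (elemMap e x) * polyEval g x)‖ₑ ≤ ENNReal.ofReal M *
      ((∫⁻ x in refTet, ‖H y x‖ₑ) + ∑ x ∈ S.nodes, ‖S.weight x‖ₑ * ‖H y x‖ₑ) := by
    intro y
    obtain ⟨q, hq, hqe⟩ := exists_polyEval_eq_taylorAt (elemPoly e) (totalDegree_elemPoly_le e)
      (elemMap e) (elemMap_apply e) m v y
    have h1 : Continuous fun x => v (elemMap e x) * polyEval g x :=
      (hv.continuous.comp (continuous_elemMap e)).mul (continuous_polyEval g)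
    have h2 : Continuous fun x => polyEval q x * polyEval g x :=
      (continuous_polyEval q).mul (continuous_polyEval g)
    have h3 : refErr S (fun x => v (elemMap e x) * polyEval g x) =
        refErr S (fun x => H y x * polyEval g x) := by
      rw [← sub_zero (refErr S fun x => v (elemMap e x) * polyEval g x), ← hex q hq,
        ← refErr_sub S h1.continuousOn h2.continuousOn]
      congr 1
      funext x
      simp only [hH, hqe]
      ring
    rw [h3]
    exact enorm_refErr_mul_le S _ _ hM
  have hmeas : Measurable fun y => ∫⁻ x in refTet, ‖H y x‖ₑ :=
    (hHc.enorm.measurable).lintegral_prod_right'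
  -- The left side does not depend on y, so it may be averaged over K. After exchanging the
  -- integrals, the averaged remainder bound B applies at each x, in the integral and at each node
  -- alike.
  calc volume K * ‖refErr S (fun x => v (elemMap e x) * polyEval g x)‖ₑ
      = ∫⁻ _y in K, ‖refErr S (fun x => v (elemMap e x) * polyEval g x)‖ₑ := by
        simp [mul_comm]
    _ ≤ ∫⁻ y in K, ENNReal.ofReal M *
          ((∫⁻ x in refTet, ‖H y x‖ₑ) + ∑ x ∈ S.nodes, ‖S.weight x‖ₑ * ‖H y x‖ₑ) :=
        lintegral_mono hy
    _ = ENNReal.ofReal M * ((∫⁻ x in refTet, ∫⁻ y in K, ‖H y x‖ₑ) +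
          ∑ x ∈ S.nodes, ‖S.weight x‖ₑ * ∫⁻ y in K, ‖H y x‖ₑ) := by
        have hyc : ∀ x, Measurable fun y => ‖H y x‖ₑ := fun x =>
          (hHc.comp (by fun_prop : Continuous fun y : E3 => (y, x))).enorm.measurable
        rw [lintegral_const_mul' _ _ ENNReal.ofReal_ne_top, lintegral_add_left hmeas,
          lintegral_lintegral_swap hHc.enorm.measurable.aemeasurable,
          lintegral_finsetSum _ fun x _ => (hyc x).const_mul _]
        congr 2
        exact Finset.sum_congr rfl fun x _ => lintegral_const_mul _ (hyc x)
    _ ≤ ENNReal.ofReal M * ((∫⁻ _x in refTet, B) + ∑ x ∈ S.nodes, ‖S.weight x‖ₑ * B) := by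
        refine mul_le_mul' le_rfl (add_le_add (setLIntegral_mono' measurableSet_refTet hB) ?_)
        exact Finset.sum_le_sum fun x hx => mul_le_mul' le_rfl (hB x (S.nodes_mem x hx))
    _ = _ := by
        rw [ofReal_quadMass, ← Finset.sum_mul, lintegral_const, Measure.restrict_apply_univ]
        ring

theorem mul_rpow_half_le_of_mul_le {V a b : ℝ≥0∞} (hV0 : V ≠ 0) (hV : V ≠ ⊤)
    (h : V * a ≤ V ^ (1 / 2 : ℝ) * b) : V ^ (1 / 2 : ℝ) * a ≤ b := by
  have h0 : V ^ (1 / 2 : ℝ) ≠ 0 := by simp [hV0]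
  have h1 : V ^ (1 / 2 : ℝ) ≠ ⊤ := ENNReal.rpow_ne_top_of_nonneg (by norm_num) hV
  have h2 : V = V ^ (1 / 2 : ℝ) * V ^ (1 / 2 : ℝ) := by
    rw [← ENNReal.rpow_add_of_nonneg _ _ (by norm_num) (by norm_num)]; norm_num
  conv_lhs at h => rw [h2]
  rw [mul_assoc] at h
  exact (ENNReal.mul_le_mul_iff_right h0 h1).1 h

/-- Limit along the smooth approximants: uniform convergence controls the error functional, which
contains point values, and L² convergence of the top derivatives controls the right-hand side. -/
theorem enorm_refErr_sobolev_le (e : Affine.Simplex ℝ E3 3) {m k : ℕ} (hm : 1 ≤ m)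
    (hmk : m + 1 ≤ k) {g : Poly3}
    (hex : ∀ f ∈ polySpace m, refErr S (fun x => polyEval f x * polyEval g x) = 0) {M : ℝ}
    (hM : ∀ x ∈ refTet, |polyEval g x| ≤ M) {d : ℝ}
    (hd : ∀ x ∈ cell e, ∀ y ∈ cell e, ‖x - y‖ ≤ d) {u : E3 → ℝ}
    (hu2 : MemLp u 2 (volume.restrict (interior (cell e))))
    (hu : MemSobolev k (interior (cell e)) u) :
    (volume (cell e)) ^ (1 / 2 : ℝ) *
        ‖refErr S (fun x => contRep (cell e) u (elemMap e x) * polyEval g x)‖ₑ ≤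
      ENNReal.ofReal M * ENNReal.ofReal (quadMass S) * (ENNReal.ofReal ((3 * d) ^ (m + 1)) * 2) *
          ∑ α ∈ topIndices (m + 1),
            eLpNorm (weakD (interior (cell e)) α u) 2 (volume.restrict (cell e)) := by
  obtain ⟨⟨hc, -⟩, v, hv, hunif, hconv⟩ := exists_smooth_approx (convex_cell e) (isCompact_cell e)
    (interior_cell_nonempty e) (by omega : 2 ≤ k) hu2 hu
  set K := cell e
  have hKfin : volume K ≠ ⊤ := (isCompact_cell e).measure_ne_top
  have hK0 : volume K ≠ 0 := fun h => (volume_real_cell_pos e).ne' (by simp [Measure.real, K, h])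
  set A := ENNReal.ofReal M * ENNReal.ofReal (quadMass S) *
    (ENNReal.ofReal ((3 * d) ^ (m + 1)) * 2) with hA
  have hAfin : A ≠ ⊤ := by
    refine ENNReal.mul_ne_top (ENNReal.mul_ne_top ?_ ?_) (ENNReal.mul_ne_top ?_ ?_) <;> simp
  set r := (volume K) ^ (1 / 2 : ℝ)
  have hr : r ≠ ⊤ := ENNReal.rpow_ne_top_of_nonneg (by norm_num) hKfin
  set N := ∑ α ∈ topIndices (m + 1), eLpNorm (weakD (interior K) α u) 2 (volume.restrict K)
  set b : ℕ → ℝ≥0∞ := fun n => ∑ α ∈ topIndices (m + 1), eLpNorm (fun x => multiD α (v n) x -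
    weakD (interior K) α u x) 2 (volume.restrict K) with hb
  have hblim : Tendsto b atTop (𝓝 0) := by
    have h1 : Tendsto b atTop (𝓝 (∑ α ∈ topIndices (m + 1), (0 : ℝ≥0∞))) :=
      tendsto_finsetSum _ fun α hα => hconv α (topIndices_subset hmk hα)
    rwa [Finset.sum_const_zero] at h1
  have hn : ∀ n, r * ‖refErr S (fun x => v n (elemMap e x) * polyEval g x)‖ₑ ≤ A * (N + b n) := by
    intro n
    have h1 := enorm_refErr_smooth_le S e hm hex hM hd (hv n)
    have h2 : ∑ α ∈ topIndices (m + 1), eLpNorm (multiD α (v n)) 2 (volume.restrict K) ≤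
        N + b n := by
      rw [hb]
      simp only
      rw [← Finset.sum_add_distrib]
      refine Finset.sum_le_sum fun α hα => ?_
      have hw : AEStronglyMeasurable (weakD (interior K) α u) (volume.restrict K) := by
        rw [← restrict_interior_eq (convex_cell e)]
        exact (weakD_spec hu (topIndices_subset hmk hα)).1.1
      have e1 : multiD α (v n) = weakD (interior K) α u +
          fun x => multiD α (v n) x - weakD (interior K) α u x := by
        funext x; simp
      conv_lhs => rw [e1]
      exact eLpNorm_add_le hw
        ((contDiff_multiD (hv n) α).continuous.aestronglyMeasurable.sub hw) (by norm_num)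
    refine mul_rpow_half_le_of_mul_le hK0 hKfin (h1.trans ?_)
    calc _ = r * (A * ∑ α ∈ topIndices (m + 1),
          eLpNorm (multiD α (v n)) 2 (volume.restrict K)) := by rw [hA]; ring
      _ ≤ _ := by gcongr
  have hdiff : ∀ ε : ℝ, 0 < ε → ∀ᶠ n in atTop,
      r * ‖refErr S (fun x => contRep K u (elemMap e x) * polyEval g x)‖ₑ ≤
        A * (N + b n) + r * (ENNReal.ofReal M * ENNReal.ofReal (quadMass S)) * ENNReal.ofReal ε := by
    intro ε hε
    filter_upwards [Metric.tendstoUniformlyOn_iff.1 hunif ε hε] with n hnε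
    set F : E3 → ℝ := fun x => contRep K u (elemMap e x) - v n (elemMap e x) with hF
    have hFε : ∀ x ∈ refTet, ‖F x‖ₑ ≤ ENNReal.ofReal ε := fun x hx => by
      rw [Real.enorm_eq_ofReal_abs]
      exact ENNReal.ofReal_le_ofReal (hnε _ (elemMap_mem_cell e hx)).le
    have c1 : ContinuousOn (fun x => contRep K u (elemMap e x) * polyEval g x) refTet :=
      (hc.comp (continuous_elemMap e).continuousOn fun x hx => elemMap_mem_cell e hx).mul
        (continuous_polyEval g).continuousOn
    have c2 : ContinuousOn (fun x => v n (elemMap e x) * polyEval g x) refTet :=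
      (((hv n).continuous.comp (continuous_elemMap e)).mul (continuous_polyEval g)).continuousOn
    have h3 : refErr S (fun x => contRep K u (elemMap e x) * polyEval g x) =
        refErr S (fun x => v n (elemMap e x) * polyEval g x) +
          refErr S (fun x => F x * polyEval g x) := by
      have : (fun x => F x * polyEval g x) = fun x =>
          contRep K u (elemMap e x) * polyEval g x - v n (elemMap e x) * polyEval g x := by
        funext x; simp only [hF]; ring
      rw [this, refErr_sub S c1 c2]
      ring
    have h4 : ‖refErr S (fun x => F x * polyEval g x)‖ₑ ≤
        ENNReal.ofReal M * (ENNReal.ofReal (quadMass S) * ENNReal.ofReal ε) := by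
      refine (enorm_refErr_mul_le S _ _ hM).trans (mul_le_mul' le_rfl ?_)
      rw [ofReal_quadMass, add_mul, Finset.sum_mul]
      refine add_le_add ?_ (Finset.sum_le_sum fun x hx =>
        mul_le_mul' le_rfl (hFε x (S.nodes_mem x hx)))
      refine (setLIntegral_mono' measurableSet_refTet hFε).trans ?_
      rw [lintegral_const, Measure.restrict_apply_univ, mul_comm]
    rw [h3]
    calc _ ≤ r * (‖refErr S (fun x => v n (elemMap e x) * polyEval g x)‖ₑ +
            ‖refErr S (fun x => F x * polyEval g x)‖ₑ) := by gcongr; exact enorm_add_le _ _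
      _ ≤ A * (N + b n) + r * (ENNReal.ofReal M * (ENNReal.ofReal (quadMass S) *
            ENNReal.ofReal ε)) := by
          rw [mul_add]
          exact add_le_add (hn n) (mul_le_mul' le_rfl h4)
      _ = _ := by ring
  have hε : ∀ ε : ℝ, 0 < ε →
      r * ‖refErr S (fun x => contRep K u (elemMap e x) * polyEval g x)‖ₑ ≤
        A * N + r * (ENNReal.ofReal M * ENNReal.ofReal (quadMass S)) * ENNReal.ofReal ε := by
    intro ε hε
    refine ge_of_tendsto ?_ (hdiff ε hε)
    refine Tendsto.add ?_ tendsto_const_nhds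
    refine ENNReal.Tendsto.const_mul ?_ (Or.inr hAfin)
    simpa using (tendsto_const_nhds (x := N)).add hblim
  have hlim : Tendsto (fun ε : ℝ => A * N + r * (ENNReal.ofReal M * ENNReal.ofReal (quadMass S)) *
      ENNReal.ofReal ε) (𝓝[>] 0) (𝓝 (A * N + r * (ENNReal.ofReal M *
        ENNReal.ofReal (quadMass S)) * ENNReal.ofReal 0)) := by
    refine tendsto_const_nhds.add (ENNReal.Tendsto.const_mul
      ((ENNReal.continuous_ofReal.tendsto 0).mono_left nhdsWithin_le_nhds) (Or.inr ?_))
    exact ENNReal.mul_ne_top hr (ENNReal.mul_ne_top ENNReal.ofReal_ne_top ENNReal.ofReal_ne_top)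
  simp only [ENNReal.ofReal_zero, mul_zero, add_zero] at hlim
  exact ge_of_tendsto hlim (eventually_mem_nhdsWithin.mono fun ε h => hε ε h)

end ReferenceError

/-! ### Real-valued local error bound. -/

section LocalBound

variable (S : QuadRule) (e : Affine.Simplex ℝ E3 3)

/-- The constant in the local error bound for exactness degree `m`. -/
def localConst (m : ℕ) : ℝ :=
  quadMass S * (2 * 3 ^ (m + 1)) * (topIndices (m + 1)).card / volume.real refTet

theorem localConst_nonneg (m : ℕ) : 0 ≤ localConst S m := by
  have := quadMass_pos S
  have := volume_real_refTet_pos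
  unfold localConst
  positivity

theorem nonneg_of_cell_bound {d : ℝ} (hd : ∀ x ∈ cell e, ∀ y ∈ cell e, ‖x - y‖ ≤ d) : 0 ≤ d := by
  obtain ⟨x, hx⟩ := interior_cell_nonempty e
  exact (norm_nonneg _).trans (hd x (interior_subset hx) x (interior_subset hx))

theorem sobolevNormSq_nonneg (k : ℕ) (O : Set E3) (u : E3 → ℝ) : 0 ≤ sobolevNormSq k O u :=
  Finset.sum_nonneg fun _ _ => integral_nonneg fun _ => sq_nonneg _

theorem integral_weakD_sq_le {k : ℕ} {α : Fin 3 → ℕ} (hα : α ∈ multiIndices k) (O : Set E3)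
    (u : E3 → ℝ) : ∫ x in O, weakD O α u x ^ 2 ≤ sobolevNormSq k O u :=
  Finset.single_le_sum (f := fun α => ∫ x in O, weakD O α u x ^ 2)
    (fun _ _ => integral_nonneg fun _ => sq_nonneg _) hα

/-- One of the two factors √|e| in |e| is absorbed by the Sobolev estimate; the other stays beside M
and will convert a reference L² norm into a physical one. Order n may exceed m + 1, which allows a
common norm for two exactness degrees. -/
theorem volRatio_mul_abs_refErr_le {m n k : ℕ} (hm : 1 ≤ m) (hmn : m + 1 ≤ n) (hnk : n ≤ k)
    {g : Poly3} (hex : ∀ f ∈ polySpace m, refErr S (fun x => polyEval f x * polyEval g x) = 0)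
    {M : ℝ} (hM : ∀ x ∈ refTet, |polyEval g x| ≤ M) {d : ℝ}
    (hd : ∀ x ∈ cell e, ∀ y ∈ cell e, ‖x - y‖ ≤ d) {u : E3 → ℝ}
    (hu2 : MemLp u 2 (volume.restrict (interior (cell e))))
    (hu : MemSobolev k (interior (cell e)) u) :
    volRatio e * |refErr S (fun x => contRep (cell e) u (elemMap e x) * polyEval g x)| ≤
      localConst S m * d ^ (m + 1) * (M * √(volume.real (cell e))) *
        √(sobolevNormSq n (interior (cell e)) u) := by
  set K := cell e
  set E := refErr S (fun x => contRep K u (elemMap e x) * polyEval g x)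
  have hd0 : 0 ≤ d := nonneg_of_cell_bound e hd
  have hM0 : 0 ≤ M := by
    obtain ⟨x, hx⟩ := interior_refTet_nonempty
    exact (abs_nonneg _).trans (hM x (interior_subset hx))
  have hQ := quadMass_pos S
  have hV := volume_real_cell_pos e
  have hR := volume_real_refTet_pos
  set N := √(sobolevNormSq n (interior K) u)
  have hsum : ∑ α ∈ topIndices (m + 1), eLpNorm (weakD (interior K) α u) 2 (volume.restrict K) ≤
      ENNReal.ofReal ((topIndices (m + 1)).card * N) := by
    have h1 : ∀ α ∈ topIndices (m + 1),
        eLpNorm (weakD (interior K) α u) 2 (volume.restrict K) ≤ ENNReal.ofReal N := by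
      intro α hα
      rw [← restrict_interior_eq (convex_cell e), eLpNorm_two_eq_ofReal_sqrt
        (weakD_spec hu (topIndices_subset (hmn.trans hnk) hα)).1]
      exact ENNReal.ofReal_le_ofReal
        (Real.sqrt_le_sqrt (integral_weakD_sq_le (topIndices_subset hmn hα) _ _))
    refine (Finset.sum_le_card_nsmul _ _ _ h1).trans ?_
    rw [nsmul_eq_mul, ENNReal.ofReal_mul (Nat.cast_nonneg _), ENNReal.ofReal_natCast]
  have hvol : (volume K) ^ (1 / 2 : ℝ) = ENNReal.ofReal (√(volume.real K)) := by
    rw [← ofReal_measureReal (isCompact_cell e).measure_ne_top,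
      ENNReal.ofReal_rpow_of_nonneg measureReal_nonneg (by norm_num), Real.sqrt_eq_rpow]
  have h := (enorm_refErr_sobolev_le S e hm (hmn.trans hnk) hex hM hd hu2 hu).trans
    (mul_le_mul' le_rfl hsum)
  have htwo : ENNReal.ofReal ((3 * d) ^ (m + 1)) * 2 = ENNReal.ofReal ((3 * d) ^ (m + 1) * 2) := by
    rw [ENNReal.ofReal_mul (by positivity), ENNReal.ofReal_ofNat]
  rw [hvol, Real.enorm_eq_ofReal_abs, ← ENNReal.ofReal_mul (by positivity), htwo,
    ← ENNReal.ofReal_mul hM0, ← ENNReal.ofReal_mul (by positivity),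
    ← ENNReal.ofReal_mul (by positivity), ENNReal.ofReal_le_ofReal_iff (by positivity)] at h
  have hVs : volume.real K = √(volume.real K) * √(volume.real K) :=
    (Real.mul_self_sqrt hV.le).symm
  calc volRatio e * |E| = √(volume.real K) / volume.real refTet * (√(volume.real K) * |E|) := by
        rw [volRatio]
        change volume.real K / _ * _ = _
        conv_lhs => rw [hVs]
        ring
    _ ≤ √(volume.real K) / volume.real refTet * (M * quadMass S * ((3 * d) ^ (m + 1) * 2) *
          ((topIndices (m + 1)).card * N)) := by
        exact mul_le_mul_of_nonneg_left h (by positivity)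
    _ = _ := by
        rw [localConst, mul_pow]
        ring

end LocalBound

/-! ### The discrete function on a physical element and its norms. -/

section PiecewisePolynomial

variable (e : Affine.Simplex ℝ E3 3)

/-- A reference polynomial transported to the physical element. -/
def physPoly (g : Poly3) (y : E3) : ℝ := polyEval g (elemInv e y)

theorem contDiff_physPoly (g : Poly3) : ContDiff ℝ ∞ (physPoly e g) :=
  (contDiff_polyEval g).comp (contDiff_elemInv e)

theorem physPoly_elemMap (g : Poly3) (x : E3) : physPoly e g (elemMap e x) = polyEval g x := by
  simp [physPoly]

variable {e} {τ : E3 → ℝ} {g : Poly3}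

theorem ae_eq_physPoly (h : ∀ᵐ x ∂volume.restrict refTet, τ (elemMap e x) = polyEval g x) :
    physPoly e g =ᵐ[volume.restrict (cell e)] τ := by
  refine ae_cell_of_ae_refTet e ?_
  filter_upwards [h] with x hx
  rw [hx, physPoly_elemMap]

theorem contRep_elemMap (h : ∀ᵐ x ∂volume.restrict refTet, τ (elemMap e x) = polyEval g x) {x : E3}
    (hx : x ∈ refTet) : contRep (cell e) τ (elemMap e x) = polyEval g x := by
  rw [contRep_eqOn (convex_cell e) (interior_cell_nonempty e)
    (contDiff_physPoly e g).continuous.continuousOn (ae_eq_physPoly h) (elemMap_mem_cell e hx),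
    physPoly_elemMap]

theorem integral_sq_eq (h : ∀ᵐ x ∂volume.restrict refTet, τ (elemMap e x) = polyEval g x) :
    ∫ y in cell e, τ y ^ 2 = volRatio e * ∫ x in refTet, polyEval g x ^ 2 := by
  rw [setIntegral_cell]
  congr 1
  refine integral_congr_ae ?_
  filter_upwards [h] with x hx
  rw [hx]

/-- On the element τ agrees almost everywhere with a smooth function, so integration by parts
against a test function applies. -/
theorem isWeakDeriv_physPoly (h : ∀ᵐ x ∂volume.restrict refTet, τ (elemMap e x) = polyEval g x)
    (hτ : MemLp τ 2 (volume.restrict (interior (cell e)))) (j : Fin 3) :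
    IsWeakDeriv (interior (cell e)) (Pi.single j 1) τ (partialD j (physPoly e g)) := by
  have hs := contDiff_physPoly e g
  have hc1 : Continuous (partialD j (physPoly e g)) := (contDiff_partialD hs j).continuous
  refine ⟨locallyIntegrableOn_of_locallyIntegrable_restrict (hτ.locallyIntegrable (by norm_num)),
    hc1.locallyIntegrable.locallyIntegrableOn _, ?_⟩
  intro φ hφ hφs hφt
  have hts : tsupport (partialD j φ) ⊆ interior (cell e) := by
    refine (closure_minimal ?_ (isClosed_tsupport φ)).trans hφt
    intro x hx
    by_contra hn
    have h0 : fderiv ℝ φ x = 0 :=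
      image_eq_zero_of_notMem_tsupport fun h' => hn (tsupport_fderiv_subset ℝ h')
    exact hx (by simp [partialD, h0])
  have hcs := hasCompactSupport_partialD hφs j
  have hc2 : Continuous (partialD j φ) := (contDiff_partialD hφ j).continuous
  have hloc : ∀ {f : E3 → ℝ}, Continuous f → LocallyIntegrableOn f (interior (cell e)) volume :=
    fun hf => hf.locallyIntegrable.locallyIntegrableOn _
  rw [multiD_single]
  have h1 : ∫ x in interior (cell e), τ x * partialD j φ x =
      ∫ x in interior (cell e), physPoly e g x * partialD j φ x := by
    refine integral_congr_ae ?_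
    rw [restrict_interior_eq (convex_cell e)]
    filter_upwards [ae_eq_physPoly h] with x hx
    rw [hx]
  rw [h1, setIntegral_mul_of_tsupport_subset hts, setIntegral_mul_of_tsupport_subset hφt]
  have h2 := integral_mul_fderiv_eq_neg_fderiv_mul_of_integrable (μ := volume)
    (f := physPoly e g) (g := φ) (v := EuclideanSpace.single j 1)
    (integrable_mul_of_tsupport_subset (hloc hc1) hφ.continuous hφs hφt)
    (integrable_mul_of_tsupport_subset (hloc hs.continuous) hc2 hcs hts)
    (integrable_mul_of_tsupport_subset (hloc hs.continuous) hφ.continuous hφs hφt)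
    (fun x _ => hs.differentiable (by simp) x) (fun x _ => hφ.differentiable (by simp) x)
  simpa [partialD] using h2

theorem integral_sq_le_sobolevNormSq (hτ : MemLp τ 2 (volume.restrict (interior (cell e)))) (k : ℕ) :
    ∫ y in cell e, τ y ^ 2 ≤ sobolevNormSq k (interior (cell e)) τ := by
  refine le_trans (le_of_eq ?_) (integral_weakD_sq_le (mem_multiIndices.2 (by simp) :
    (0 : Fin 3 → ℕ) ∈ multiIndices k) _ _)
  rw [← restrict_interior_eq (convex_cell e)]
  refine integral_congr_ae ?_
  filter_upwards [weakD_zero_ae_eq isOpen_interior hτ] with x hx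
  rw [hx]

theorem sum_integral_partialD_sq_le
    (h : ∀ᵐ x ∂volume.restrict refTet, τ (elemMap e x) = polyEval g x)
    (hτ : MemLp τ 2 (volume.restrict (interior (cell e)))) :
    ∑ j, ∫ y in cell e, partialD j (physPoly e g) y ^ 2 ≤
      sobolevNormSq 1 (interior (cell e)) τ := by
  have h1 : ∀ j, ∫ y in cell e, partialD j (physPoly e g) y ^ 2 =
      ∫ y in interior (cell e), weakD (interior (cell e)) (Pi.single j 1) τ y ^ 2 := by
    intro j
    have hw := isWeakDeriv_physPoly h hτ j
    have hmem : MemLp (partialD j (physPoly e g)) 2 (volume.restrict (interior (cell e))) := by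
      rw [restrict_interior_eq (convex_cell e)]
      exact memLp_of_continuousOn (isCompact_cell e)
        (contDiff_partialD (contDiff_physPoly e g) j).continuous.continuousOn
    rw [← restrict_interior_eq (convex_cell e)]
    refine integral_congr_ae ?_
    filter_upwards [(weakD_spec_of_exists hmem hw).2.ae_eq isOpen_interior hw] with x hx
    rw [hx]
  simp only [h1]
  have hinj : Function.Injective fun j : Fin 3 => (Pi.single j 1 : Fin 3 → ℕ) := by
    intro i j hij
    by_contra hne
    have := congrFun hij i
    simp [hne] at this
  rw [← Finset.sum_image (f := fun α => ∫ y in interior (cell e),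
    weakD (interior (cell e)) α τ y ^ 2) hinj.injOn]
  refine Finset.sum_le_sum_of_subset_of_nonneg ?_
    fun _ _ _ => integral_nonneg fun _ => sq_nonneg _
  intro α hα
  obtain ⟨j, -, rfl⟩ := Finset.mem_image.1 hα
  exact mem_multiIndices.2 (by simp)

theorem single_mem_refTet (i : Fin 3) : EuclideanSpace.single i (1 : ℝ) ∈ refTet := by
  intro j
  fin_cases i <;> fin_cases j <;> simp [bary]

theorem zero_mem_refTet : (0 : E3) ∈ refTet := by
  intro j
  fin_cases j <;> simp [bary]

/-- By the chain rule ∂_i g is the derivative of the physical polynomial along the edge vector from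
φ(0) to φ(e_i), whose length is at most d. The inverse of the element map is not estimated, so flat
elements cause no loss. The factor 3 counts the directions i. -/
theorem volRatio_mul_sum_pderiv_sq_le {d : ℝ}
    (hd : ∀ x ∈ cell e, ∀ y ∈ cell e, ‖x - y‖ ≤ d)
    (h : ∀ᵐ x ∂volume.restrict refTet, τ (elemMap e x) = polyEval g x)
    (hτ : MemLp τ 2 (volume.restrict (interior (cell e)))) :
    volRatio e * ∑ i, ∫ x in refTet, polyEval (MvPolynomial.pderiv i g) x ^ 2 ≤
      3 * d ^ 2 * sobolevNormSq 1 (interior (cell e)) τ := by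
  have hd0 : 0 ≤ d := nonneg_of_cell_bound e hd
  set t := physPoly e g
  have ht : ContDiff ℝ ∞ t := contDiff_physPoly e g
  have hA : ∀ i : Fin 3, ‖elemEquiv e (EuclideanSpace.single i 1)‖ ≤ d := by
    intro i
    have := hd _ (elemMap_mem_cell e (single_mem_refTet i)) _ (elemMap_mem_cell e zero_mem_refTet)
    simpa [elemMap_eq] using this
  have hpt : ∀ (i : Fin 3) (x : E3), polyEval (MvPolynomial.pderiv i g) x ^ 2 ≤
      d ^ 2 * ∑ j, partialD j t (elemMap e x) ^ 2 := by
    intro i x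
    set z := elemEquiv e (EuclideanSpace.single i 1)
    have e1 : polyEval g = t ∘ elemMap e := by
      funext x; exact (physPoly_elemMap e g x).symm
    have e2 : polyEval (MvPolynomial.pderiv i g) x = ∑ j, z j * partialD j t (elemMap e x) := by
      rw [← partialD_polyEval, partialD, e1, ((ht.differentiable (by simp) _).hasFDerivAt.comp x
        (hasFDerivAt_elemMap e x)).fderiv, ← fderiv_eq_sum_partialD]
      rfl
    rw [e2]
    refine (Finset.sum_mul_sq_le_sq_mul_sq _ _ _).trans ?_
    refine mul_le_mul_of_nonneg_right ?_ (Finset.sum_nonneg fun _ _ => sq_nonneg _)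
    have e3 : ∑ j, z j ^ 2 = ‖z‖ ^ 2 := by simp [EuclideanSpace.norm_sq_eq]
    rw [e3]
    gcongr
    exact hA i
  have hcont : ∀ j, Continuous fun x => partialD j t (elemMap e x) ^ 2 := fun j =>
    ((contDiff_partialD ht j).continuous.comp (continuous_elemMap e)).pow 2
  have hintg : ∀ i : Fin 3, ∫ x in refTet, polyEval (MvPolynomial.pderiv i g) x ^ 2 ≤
      d ^ 2 * ∑ j, ∫ x in refTet, partialD j t (elemMap e x) ^ 2 := by
    intro i
    rw [← integral_finsetSum _ fun j _ => integrableOn_refTet (hcont j).continuousOn,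
      ← integral_const_mul]
    refine setIntegral_mono (integrableOn_refTet ((continuous_polyEval _).pow 2).continuousOn)
      (integrableOn_refTet ?_) (hpt i)
    exact (continuous_const.mul (continuous_finsetSum _ fun j _ => hcont j)).continuousOn
  have hsum : volRatio e * ∑ j, ∫ x in refTet, partialD j t (elemMap e x) ^ 2 ≤
      sobolevNormSq 1 (interior (cell e)) τ := by
    refine le_trans (le_of_eq ?_) (sum_integral_partialD_sq_le h hτ)
    rw [Finset.mul_sum]
    exact Finset.sum_congr rfl fun j _ => (setIntegral_cell e fun y => partialD j t y ^ 2).symm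
  calc _ ≤ volRatio e * ∑ _i : Fin 3, d ^ 2 * ∑ j, ∫ x in refTet, partialD j t (elemMap e x) ^ 2 :=
        mul_le_mul_of_nonneg_left (Finset.sum_le_sum fun i _ => hintg i) (volRatio_pos e).le
    _ = 3 * d ^ 2 * (volRatio e * ∑ j, ∫ x in refTet, partialD j t (elemMap e x) ^ 2) := by
        simp; ring
    _ ≤ _ := mul_le_mul_of_nonneg_left hsum (by positivity)

/-- Scaling of `L²` norms between the reference and the physical element. -/
theorem sqrt_mul_sqrt_volume_le {X Y : ℝ} (h : volRatio e * X ≤ Y) :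
    √X * √(volume.real (cell e)) ≤ √(volume.real refTet) * √Y := by
  have h1 : volume.real (cell e) = volume.real refTet * volRatio e := by
    rw [volRatio, mul_div_cancel₀ _ volume_real_refTet_pos.ne']
  rw [h1, Real.sqrt_mul volume_real_refTet_pos.le, mul_left_comm, mul_comm √X,
    ← Real.sqrt_mul (volRatio_pos e).le]
  gcongr

end PiecewisePolynomial

/-! ### Polynomial exactness of the quadrature rule. -/

section Exactness

variable {S : QuadRule} {p : ℕ} {U : Submodule ℝ Poly3}

theorem refErr_eq_zero_of_stiffnessExact (hp : 2 ≤ p) (h : S.StiffnessExact p U) {m : ℕ}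
    (hm : m + 1 ≤ p) {g : Poly3} (hg : g ∈ derivSpace U) {f : Poly3} (hf : f ∈ polySpace m) :
    refErr S (fun x => polyEval f x * polyEval g x) = 0 := by
  unfold refErr
  rw [h hp f (polySpace_mono (by omega) hf) g hg, sub_self]

/-- A nonconstant monomial of degree at most p factors as a monomial of degree at most p - 1 times
some X_i ∈ DU, so C8 applies to it. The constant monomial is covered by 1 ∈ DU. -/
theorem refErr_one_eq_zero_of_stiffnessExact (hp : 2 ≤ p) (h : S.StiffnessExact p U)
    (hU : polySpace p ≤ U) {f : Poly3} (hf : f ∈ polySpace p) :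
    refErr S (fun x => polyEval f x * polyEval 1 x) = 0 := by
  have hU2 : polySpace 2 ≤ U := (polySpace_mono hp).trans hU
  rw [MvPolynomial.mem_restrictTotalDegree] at hf
  have key : ∀ s ∈ f.support,
      refErr S (polyEval (MvPolynomial.monomial s (f.coeff s))) = 0 := by
    intro s hs
    have hdeg : s.degree ≤ p := (MvPolynomial.le_totalDegree hs).trans hf
    by_cases h0 : s = 0
    · subst h0
      have h1 := refErr_eq_zero_of_stiffnessExact hp h (m := p - 1) (by omega)
        (one_mem_derivSpace hU2) (f := MvPolynomial.C (f.coeff 0))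
        (by rw [MvPolynomial.mem_restrictTotalDegree]; simp)
      rw [← h1]
      congr 1
      funext x
      simp [polyEval]
    · obtain ⟨i, hi⟩ := Finsupp.ne_iff.1 h0
      have hle : Finsupp.single i 1 ≤ s := by
        rw [Finsupp.single_le_iff]
        exact Nat.one_le_iff_ne_zero.2 hi
      have hsd : s - Finsupp.single i 1 + Finsupp.single i 1 = s := tsub_add_cancel_of_le hle
      have hdeg2 : (s - Finsupp.single i 1).degree + 1 = s.degree := by
        conv_rhs => rw [← hsd]
        simp
      have h1 := refErr_eq_zero_of_stiffnessExact hp h (m := p - 1) (by omega)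
        (X_mem_derivSpace hU2 i) (f := MvPolynomial.monomial (s - Finsupp.single i 1) (f.coeff s))
        (by
          rw [MvPolynomial.mem_restrictTotalDegree]
          refine (MvPolynomial.totalDegree_monomial_le _ _).trans ?_
          change (s - Finsupp.single i 1).degree ≤ p - 1
          omega)
      rw [← h1]
      congr 1
      funext x
      have : MvPolynomial.monomial s (f.coeff s) =
          MvPolynomial.monomial (s - Finsupp.single i 1) (f.coeff s) * MvPolynomial.X i := by
        rw [MvPolynomial.X, MvPolynomial.monomial_mul, hsd, mul_one]
      rw [this]
      simp only [polyEval, map_mul]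
  have hsum : (fun x => polyEval f x * polyEval 1 x) = fun x => ∑ s ∈ f.support,
      polyEval (MvPolynomial.monomial s (f.coeff s)) x := by
    funext x
    have h1 : polyEval f x = polyEval (∑ s ∈ f.support, MvPolynomial.monomial s (f.coeff s)) x := by
      rw [MvPolynomial.support_sum_monomial_coeff]
    have h2 : polyEval 1 x = 1 := by simp [polyEval]
    rw [h1, h2, mul_one]
    simp only [polyEval, map_sum]
  rw [hsum, refErr_sum S _ _ fun s _ => (continuous_polyEval _).continuousOn]
  exact Finset.sum_eq_zero key

end Exactness

/-! ### Error bounds on a single element, uniform in its shape. -/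

section ElementError

variable (S : QuadRule)

/-- The quadrature error on a single element. -/
def elemErr (e : Affine.Simplex ℝ E3 3) (u τ : E3 → ℝ) : ℝ :=
  (∫ x in cell e, u x * τ x) - ∑ x ∈ S.nodes, volume.real (cell e) / volume.real refTet *
    S.weight x * (contRep (cell e) u (elemMap e x) * contRep (cell e) τ (elemMap e x))

variable {e : Affine.Simplex ℝ E3 3} {u τ : E3 → ℝ} {g : Poly3}

theorem elemErr_eq (hu : contRep (cell e) u =ᵐ[volume.restrict (cell e)] u)
    (h : ∀ᵐ x ∂volume.restrict refTet, τ (elemMap e x) = polyEval g x) :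
    elemErr S e u τ =
      volRatio e * refErr S (fun x => contRep (cell e) u (elemMap e x) * polyEval g x) := by
  have h1 : ∫ x in cell e, u x * τ x = ∫ x in cell e, contRep (cell e) u x * physPoly e g x := by
    refine integral_congr_ae ?_
    filter_upwards [hu, ae_eq_physPoly h] with x hx hx'
    rw [hx, hx']
  rw [elemErr, h1, setIntegral_cell, refErr, mul_sub, Finset.mul_sum]
  simp only [physPoly_elemMap]
  congr 1
  refine Finset.sum_congr rfl fun x hx => ?_
  rw [contRep_elemMap h (S.nodes_mem x hx), volRatio]
  ring

/-- The bound M is the inverse estimate C√(∫ g²); the spare √|e| turns it into the L² norm of τ on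
the element, so the constant depends only on D, S and m. -/
theorem exists_abs_elemErr_le (D : Submodule ℝ Poly3) [FiniteDimensional ℝ D] {m : ℕ} (hm : 1 ≤ m)
    (hex : ∀ g ∈ D, ∀ f ∈ polySpace m, refErr S (fun x => polyEval f x * polyEval g x) = 0) :
    ∃ C : ℝ, 0 ≤ C ∧ ∀ (e : Affine.Simplex ℝ E3 3) (d : ℝ),
      (∀ x ∈ cell e, ∀ y ∈ cell e, ‖x - y‖ ≤ d) → ∀ (k : ℕ), m + 1 ≤ k → ∀ u τ : E3 → ℝ,
      MemLp u 2 (volume.restrict (interior (cell e))) → MemSobolev k (interior (cell e)) u →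
      (∃ g ∈ D, ∀ᵐ x ∂volume.restrict refTet, τ (elemMap e x) = polyEval g x) →
      |elemErr S e u τ| ≤ C * d ^ (m + 1) *
        (√(sobolevNormSq (m + 1) (interior (cell e)) u) * √(∫ y in cell e, τ y ^ 2)) := by
  obtain ⟨C, hC, hCD⟩ := exists_abs_polyEval_le D
  refine ⟨localConst S m * C * √(volume.real refTet),
    mul_nonneg (mul_nonneg (localConst_nonneg S m) hC) (Real.sqrt_nonneg _), ?_⟩
  rintro e d hd k hk u τ hu2 hu ⟨g, hg, hτg⟩
  have hd0 := nonneg_of_cell_bound e hd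
  have hL := localConst_nonneg S m
  obtain ⟨⟨-, hcu⟩, -⟩ := exists_smooth_approx (convex_cell e) (isCompact_cell e)
    (interior_cell_nonempty e) (by omega : 2 ≤ k) hu2 hu
  rw [elemErr_eq S hcu hτg, abs_mul, abs_of_pos (volRatio_pos e)]
  refine (volRatio_mul_abs_refErr_le S e hm le_rfl hk (hex g hg) (hCD g hg) hd hu2 hu).trans ?_
  have h1 := sqrt_mul_sqrt_volume_le (integral_sq_eq hτg).ge
  set N := √(sobolevNormSq (m + 1) (interior (cell e)) u)
  calc localConst S m * d ^ (m + 1) * (C * √(∫ x in refTet, polyEval g x ^ 2) *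
        √(volume.real (cell e))) * N
      = localConst S m * d ^ (m + 1) * C * N * (√(∫ x in refTet, polyEval g x ^ 2) *
        √(volume.real (cell e))) := by ring
    _ ≤ localConst S m * d ^ (m + 1) * C * N * (√(volume.real refTet) *
        √(∫ y in cell e, τ y ^ 2)) := by
        exact mul_le_mul_of_nonneg_left h1 (by positivity)
    _ = _ := by ring

/-- The improved bound, in which the constant value `g 0` of `τ` at a vertex is split off. -/
theorem exists_abs_elemErr_le_sobolev (D : Submodule ℝ Poly3) [FiniteDimensional ℝ D] {m : ℕ}
    (hm : 1 ≤ m) (h1D : 1 ∈ D)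
    (hex : ∀ g ∈ D, ∀ f ∈ polySpace m, refErr S (fun x => polyEval f x * polyEval g x) = 0)
    (hex1 : ∀ f ∈ polySpace (m + 1), refErr S (fun x => polyEval f x * polyEval 1 x) = 0) :
    ∃ C : ℝ, 0 ≤ C ∧ ∀ (e : Affine.Simplex ℝ E3 3) (d : ℝ),
      (∀ x ∈ cell e, ∀ y ∈ cell e, ‖x - y‖ ≤ d) → ∀ (k : ℕ), m + 2 ≤ k → ∀ u τ : E3 → ℝ,
      MemLp u 2 (volume.restrict (interior (cell e))) → MemSobolev k (interior (cell e)) u →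
      MemLp τ 2 (volume.restrict (interior (cell e))) →
      (∃ g ∈ D, ∀ᵐ x ∂volume.restrict refTet, τ (elemMap e x) = polyEval g x) →
      |elemErr S e u τ| ≤ C * d ^ (m + 2) *
        (√(sobolevNormSq (m + 2) (interior (cell e)) u) *
          √(sobolevNormSq 1 (interior (cell e)) τ)) := by
  obtain ⟨C₁, hC₁, hCD₁⟩ := exists_abs_polyEval_le D
  obtain ⟨C₂, hC₂, hCD₂⟩ := exists_abs_polyEval_sub_le D
  have hL := localConst_nonneg S m
  have hL' := localConst_nonneg S (m + 1)
  refine ⟨(localConst S m * C₂ * √3 + localConst S (m + 1) * C₁) * √(volume.real refTet),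
    by positivity, ?_⟩
  rintro e d hd k hk u τ hu2 hu hτ ⟨g, hg, hτg⟩
  have hd0 := nonneg_of_cell_bound e hd
  obtain ⟨⟨hcc, hcu⟩, -⟩ := exists_smooth_approx (convex_cell e) (isCompact_cell e)
    (interior_cell_nonempty e) (by omega : 2 ≤ k) hu2 hu
  set c := polyEval g 0
  set w : E3 → ℝ := fun x => contRep (cell e) u (elemMap e x)
  have hw : ContinuousOn w refTet :=
    hcc.comp (continuous_elemMap e).continuousOn fun x hx => elemMap_mem_cell e hx
  have hgD : g - c • (1 : Poly3) ∈ D := Submodule.sub_mem _ hg (Submodule.smul_mem _ _ h1D)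
  have hge : ∀ x, polyEval (g - c • (1 : Poly3)) x = polyEval g x - c := fun x => by
    simp [polyEval]
  have h1e : ∀ x, polyEval 1 x = 1 := fun x => by simp [polyEval]
  set N := √(sobolevNormSq (m + 2) (interior (cell e)) u)
  set Y := sobolevNormSq 1 (interior (cell e)) τ
  set V := √(volume.real (cell e))
  have hsplit : refErr S (fun x => w x * polyEval g x) =
      refErr S (fun x => w x * polyEval (g - c • (1 : Poly3)) x) +
        c * refErr S (fun x => w x * polyEval 1 x) := by
    have e1 : (fun x => w x * polyEval (g - c • (1 : Poly3)) x) =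
        fun x => w x * polyEval g x - c * (w x * polyEval 1 x) := by
      funext x; rw [hge, h1e]; ring
    have c1 : ContinuousOn (fun x => w x * polyEval g x) refTet :=
      hw.mul (continuous_polyEval g).continuousOn
    have c2 : ContinuousOn (fun x => c * (w x * polyEval 1 x)) refTet :=
      continuousOn_const.mul (hw.mul (continuous_polyEval 1).continuousOn)
    rw [e1, refErr_sub S c1 c2, refErr_const_mul]
    ring
  -- The nonconstant part uses exactness of degree m only and obtains its missing power of d from
  -- the gradient in `s1`. The constant part obtains all m + 2 powers from exactness of degree m +
  -- 1.
  have b1 := volRatio_mul_abs_refErr_le S e hm (by omega : m + 1 ≤ m + 2) hk (hex _ hgD)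
    (fun x hx => by rw [hge]; exact hCD₂ g hg x hx) hd hu2 hu
  have b2 := volRatio_mul_abs_refErr_le S e (by omega : 1 ≤ m + 1) le_rfl hk hex1
    (fun x _ => by rw [h1e, abs_one]) hd hu2 hu
  have s1 : √(∑ i, ∫ x in refTet, polyEval (MvPolynomial.pderiv i g) x ^ 2) * V ≤
      √(volume.real refTet) * (√3 * d * √Y) := by
    refine (sqrt_mul_sqrt_volume_le (volRatio_mul_sum_pderiv_sq_le hd hτg hτ)).trans_eq ?_
    rw [Real.sqrt_mul (by positivity), Real.sqrt_mul (by positivity), Real.sqrt_sq hd0]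
  have s2 : |c| * V ≤ C₁ * (√(volume.real refTet) * √Y) := by
    have h2 : volRatio e * (∫ x in refTet, polyEval g x ^ 2) ≤ Y :=
      (integral_sq_eq hτg).ge.trans (integral_sq_le_sobolevNormSq hτ 1)
    calc |c| * V ≤ C₁ * √(∫ x in refTet, polyEval g x ^ 2) * V := by
          gcongr
          exact hCD₁ g hg 0 zero_mem_refTet
      _ = C₁ * (√(∫ x in refTet, polyEval g x ^ 2) * V) := by ring
      _ ≤ _ := mul_le_mul_of_nonneg_left (sqrt_mul_sqrt_volume_le h2) hC₁
  rw [elemErr_eq S hcu hτg, hsplit, abs_mul, abs_of_pos (volRatio_pos e)]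
  have hR := (volRatio_pos e).le
  calc volRatio e * |refErr S (fun x => w x * polyEval (g - c • (1 : Poly3)) x) +
        c * refErr S (fun x => w x * polyEval 1 x)|
      ≤ volRatio e * |refErr S (fun x => w x * polyEval (g - c • (1 : Poly3)) x)| +
        |c| * (volRatio e * |refErr S (fun x => w x * polyEval 1 x)|) := by
        have := abs_add_le (refErr S (fun x => w x * polyEval (g - c • (1 : Poly3)) x))
          (c * refErr S (fun x => w x * polyEval 1 x))
        rw [abs_mul] at this
        refine (mul_le_mul_of_nonneg_left this hR).trans_eq ?_
        ring
    _ ≤ localConst S m * d ^ (m + 1) *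
          (C₂ * √(∑ i, ∫ x in refTet, polyEval (MvPolynomial.pderiv i g) x ^ 2) * V) * N +
        |c| * (localConst S (m + 1) * d ^ (m + 1 + 1) * (1 * V) * N) :=
        add_le_add b1 (mul_le_mul_of_nonneg_left b2 (abs_nonneg c))
    _ = localConst S m * d ^ (m + 1) * C₂ * N *
          (√(∑ i, ∫ x in refTet, polyEval (MvPolynomial.pderiv i g) x ^ 2) * V) +
        localConst S (m + 1) * d ^ (m + 2) * N * (|c| * V) := by ring
    _ ≤ localConst S m * d ^ (m + 1) * C₂ * N * (√(volume.real refTet) * (√3 * d * √Y)) +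
        localConst S (m + 1) * d ^ (m + 2) * N * (C₁ * (√(volume.real refTet) * √Y)) :=
        add_le_add (mul_le_mul_of_nonneg_left s1 (by positivity))
          (mul_le_mul_of_nonneg_left s2 (by positivity))
    _ = _ := by ring

end ElementError

/-! ### Summation over the elements. -/

section Assembly

variable {Ω : Set E3} (T : TetMesh Ω) (S : QuadRule) {σ τ : Fin 3 → E3 → ℝ}

theorem quadError_eq_sum (hσ : ∀ i, MemLp (σ i) 2 (volume.restrict Ω))
    (hτ : ∀ i, MemLp (τ i) 2 (volume.restrict Ω)) :
    quadError T S σ τ = ∑ q ∈ T.elems ×ˢ Finset.univ, elemErr S q.1 (σ q.2) (τ q.2) := by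
  have hintg : ∀ i, IntegrableOn (fun x => σ i x * τ i x) Ω := fun i => (hσ i).integrable_mul (hτ i)
  rw [quadError, l2Inner, integral_finsetSum _ fun i _ => hintg i, TetMesh.quadInner,
    Finset.sum_product]
  simp only [setIntegral_mesh T (hintg _), elemErr]
  rw [Finset.sum_comm, ← Finset.sum_sub_distrib]
  refine Finset.sum_congr rfl fun e _ => ?_
  rw [Finset.sum_sub_distrib]
  congr 1
  rw [Finset.sum_comm]
  exact Finset.sum_congr rfl fun x _ => by rw [Finset.mul_sum]

theorem l2Norm_eq_sqrt_sum (hτ : ∀ i, MemLp (τ i) 2 (volume.restrict Ω)) :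
    l2Norm Ω τ = √(∑ q ∈ T.elems ×ˢ Finset.univ, ∫ x in cell q.1, τ q.2 x ^ 2) := by
  have hintg : ∀ i, IntegrableOn (fun x => τ i x ^ 2) Ω := fun i => (hτ i).integrable_sq
  rw [l2Norm, integral_finsetSum _ fun i _ => hintg i, Finset.sum_product]
  simp only [setIntegral_mesh T (hintg _)]
  rw [Finset.sum_comm]

theorem brokenNorm_eq_sqrt_sum (k : ℕ) (σ : Fin 3 → E3 → ℝ) : T.brokenNorm k σ =
    √(∑ q ∈ T.elems ×ˢ Finset.univ, sobolevNormSq k (interior (cell q.1)) (σ q.2)) := by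
  rw [TetMesh.brokenNorm, Finset.sum_product]

/-- Summation of element errors by the Cauchy-Schwarz inequality. -/
theorem abs_quadError_le (hσ : ∀ i, MemLp (σ i) 2 (volume.restrict Ω))
    (hτ : ∀ i, MemLp (τ i) 2 (volume.restrict Ω)) {B : ℝ} (hB : 0 ≤ B)
    (a b : Affine.Simplex ℝ E3 3 × Fin 3 → ℝ) (ha : ∀ q, 0 ≤ a q) (hb : ∀ q, 0 ≤ b q)
    (h : ∀ e ∈ T.elems, ∀ i, |elemErr S e (σ i) (τ i)| ≤ B * (√(a (e, i)) * √(b (e, i)))) :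
    |quadError T S σ τ| ≤ B * (√(∑ q ∈ T.elems ×ˢ Finset.univ, a q) *
      √(∑ q ∈ T.elems ×ˢ Finset.univ, b q)) := by
  rw [quadError_eq_sum T S hσ hτ]
  refine (Finset.abs_sum_le_sum_abs _ _).trans ?_
  calc _ ≤ ∑ q ∈ T.elems ×ˢ Finset.univ, B * (√(a q) * √(b q)) :=
        Finset.sum_le_sum fun q hq => h q.1 (Finset.mem_product.1 hq).1 q.2
    _ = B * ∑ q ∈ T.elems ×ˢ Finset.univ, √(a q) * √(b q) := by rw [Finset.mul_sum]
    _ ≤ _ := mul_le_mul_of_nonneg_left (Real.sum_sqrt_mul_sqrt_le _ ha hb) hB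

end Assembly

end MassLumped

end

/-! ### The global estimates. -/

open MassLumped in
theorem mainTheorem3 (R : RefElement) (S : QuadRule) (p : ℕ) (hp : 2 ≤ p)
    (hdeg : R.HasDegree p) (hC1 : R.Unisolvent) (hC2 : R.Symmetric) (hC3 : R.FaceConforming)
    (hC6 : S.Positive) (hC8 : S.StiffnessExact p R.space) :
    ∃ C : ℝ, 0 < C ∧ ∀ (Ω : Set E3), IsOpen Ω → Bornology.IsBounded Ω →
      ∀ (T : TetMesh Ω) (k : ℕ), 2 ≤ k → ∀ σ τ : Fin 3 → E3 → ℝ,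
        (∀ i, T.MemBrokenSobolev k (σ i)) →
        (∀ i, T.MemPiecewise (derivSpace R.space) (τ i)) →
        |quadError T S σ τ| ≤
            C * T.size ^ min p k * T.brokenNorm (min p k) σ * l2Norm Ω τ ∧
          |quadError T S σ τ| ≤
            C * T.size ^ min (p + 1) k * T.brokenNorm (min (p + 1) k) σ * T.brokenNorm 1 τ := by
  have := finiteDimensional_of_unisolvent hC1
  have := finiteDimensional_derivSpace R.space
  set D := derivSpace R.space
  have hU : polySpace p ≤ R.space := hdeg.1
  have h1D : 1 ∈ D := one_mem_derivSpace ((polySpace_mono hp).trans hU)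
  have hex : ∀ m, m + 1 ≤ p → ∀ g ∈ D, ∀ f ∈ polySpace m,
      refErr S (fun x => polyEval f x * polyEval g x) = 0 := fun m hm g hg f hf =>
    refErr_eq_zero_of_stiffnessExact hp hC8 hm hg hf
  have hloc := fun m : ℕ => fun hm : 1 ≤ m ∧ m + 1 ≤ p =>
    exists_abs_elemErr_le S D hm.1 (hex m hm.2)
  choose! c hc hcb using hloc
  obtain ⟨q, rfl⟩ : ∃ q, p = q + 1 := ⟨p - 1, by omega⟩
  obtain ⟨c', hc', hcb'⟩ := exists_abs_elemErr_le_sobolev S D (by omega : 1 ≤ q) h1D (hex q le_rfl)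
    fun f hf => refErr_one_eq_zero_of_stiffnessExact hp hC8 hU hf
  -- The order m + 1 = min(p, k) varies with k but m stays in [1, p - 1]; summing the finitely many
  -- constants makes C independent of k. The powers of 2 come from the diameter bound 2h.
  set A := ∑ m ∈ Finset.Icc 1 q, c m * 2 ^ (m + 1) with hA
  have hterm : ∀ m ∈ Finset.Icc 1 q, 0 ≤ c m * 2 ^ (m + 1) := fun m hm => by
    have h := Finset.mem_Icc.1 hm
    exact mul_nonneg (hc m ⟨h.1, by omega⟩) (by positivity)
  have hA0 : 0 ≤ A := Finset.sum_nonneg hterm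
  have hB0 : 0 ≤ c' * 2 ^ (q + 2) := by positivity
  refine ⟨1 + A + c' * 2 ^ (q + 2), by positivity, ?_⟩
  intro Ω _ _ T k hk σ τ hσ hτ
  set C := 1 + A + c' * 2 ^ (q + 2)
  have hh := size_nonneg T
  have hd : ∀ e ∈ T.elems, ∀ x ∈ cell e, ∀ y ∈ cell e, ‖x - y‖ ≤ 2 * T.size :=
    fun e he x hx y hy => norm_sub_le_of_mem_cell T he hx hy
  have hres : ∀ {f : E3 → ℝ}, MeasureTheory.MemLp f 2 (MeasureTheory.volume.restrict Ω) →
      ∀ e ∈ T.elems, MeasureTheory.MemLp f 2 (MeasureTheory.volume.restrict (interior (cell e))) :=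
    fun hf e he => hf.mono_measure (MeasureTheory.Measure.restrict_mono (T.interior_subset e he) le_rfl)
  have hσ2 := fun i => (hσ i).1
  have hτ2 := fun i => (hτ i).1
  -- Both p and k are at least 2, so m ≥ 1, as the Taylor estimate demands.
  obtain ⟨m, hmk⟩ : ∃ m, min (q + 1) k = m + 1 := ⟨min (q + 1) k - 1, by omega⟩
  have hm : 1 ≤ m ∧ m + 1 ≤ q + 1 := by omega
  have hcm : c m * 2 ^ (m + 1) ≤ C := by
    have := Finset.single_le_sum hterm (Finset.mem_Icc.2 ⟨hm.1, by omega⟩)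
    linarith
  have hB : c m * (2 * T.size) ^ (m + 1) ≤ C * T.size ^ (m + 1) := by
    rw [mul_pow, ← mul_assoc]
    exact mul_le_mul_of_nonneg_right hcm (by positivity)
  have hlow : ∀ e ∈ T.elems, ∀ i, |elemErr S e (σ i) (τ i)| ≤ C * T.size ^ (m + 1) *
      (√(sobolevNormSq (m + 1) (interior (cell e)) (σ i)) * √(∫ y in cell e, τ i y ^ 2)) := by
    intro e he i
    refine (hcb m hm e _ (hd e he) k (by omega) (σ i) (τ i) (hres (hσ2 i) e he) ((hσ i).2 e he)
      ((hτ i).2 e he)).trans ?_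
    exact mul_le_mul_of_nonneg_right hB (by positivity)
  have hC0 : 0 ≤ C := by positivity
  constructor
  · rw [hmk, brokenNorm_eq_sqrt_sum, l2Norm_eq_sqrt_sum T hτ2, mul_assoc (C * T.size ^ (m + 1))]
    exact abs_quadError_le T S hσ2 hτ2 (by positivity)
      (fun q => sobolevNormSq (m + 1) (interior (cell q.1)) (σ q.2))
      (fun q => ∫ y in cell q.1, τ q.2 y ^ 2) (fun q => sobolevNormSq_nonneg _ _ _)
      (fun q => MeasureTheory.integral_nonneg fun _ => sq_nonneg _) hlow
  · rw [brokenNorm_eq_sqrt_sum, brokenNorm_eq_sqrt_sum, mul_assoc (C * T.size ^ min (q + 1 + 1) k)]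
    refine abs_quadError_le T S hσ2 hτ2 (by positivity)
      (fun r => sobolevNormSq (min (q + 1 + 1) k) (interior (cell r.1)) (σ r.2))
      (fun q => sobolevNormSq 1 (interior (cell q.1)) (τ q.2)) (fun q => sobolevNormSq_nonneg _ _ _)
      (fun q => sobolevNormSq_nonneg _ _ _) fun e he i => ?_
    -- If k ≤ p, both minima equal k and the first bound suffices, because the L² norm of τ on each
    -- element is dominated by its H¹ norm. Otherwise k ≥ p + 1 and the improved element bound
    -- applies.
    rcases le_or_gt k (q + 1) with hkq | hkq
    · have e1 : min (q + 1 + 1) k = m + 1 := by omega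
      rw [e1]
      refine (hlow e he i).trans ?_
      gcongr
      exact integral_sq_le_sobolevNormSq (hres (hτ2 i) e he) 1
    · have e1 : min (q + 1 + 1) k = q + 2 := by omega
      rw [e1]
      refine (hcb' e _ (hd e he) k (by omega) (σ i) (τ i) (hres (hσ2 i) e he) ((hσ i).2 e he)
        (hres (hτ2 i) e he) ((hτ i).2 e he)).trans ?_
      refine mul_le_mul_of_nonneg_right ?_ (by positivity)
      rw [mul_pow, ← mul_assoc]
      exact mul_le_mul_of_nonneg_right (by linarith) (by positivity)
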